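/- **Setting.** Let $n\ge 2$. A strict partition is a sequence $\lambda=(\lambda_1\ge\lambda_2\ge\cdots)$ of non-negative integers with finitely many nonzero parts in which $\lambda_i=\lambda_{i+1}$ only if $\lambda_i=0$; $\ell(\lambda)$ is the number of its nonzero parts, and $D^+_\lambda=\{(i,j): 1\le i\le \ell(\lambda),\ i\le j\le \lambda_i+i-1\}$ is its shifted diagram. Let $\lambda,\mu$ be strict partitions with $D^+_\mu\subseteq D^+_\lambda$ and $\ell(\lambda)\le n$. A tableau of shifted shape $\lambda/\mu$ is a filling $T$ of $D^+_\lambda\setminus D^+_\mu$. Write $T(p,q)$ for the entry in the box $(p,p+q-1)$ (row $p$, $q$-th diagonal), which is empty if the box is not in $D^+_\lambda\setminus D^+_\mu$; write $T^{(k)}$ for the $k$-th row read from left to right, and $w_{\rm rev}(T)=T^{(\ell(\lambda))}\cdots T^{(1)}$ for the reversed reading word. A word $u_1\cdots u_s$ is a *hook word* if $u_1\ge\cdots\ge u_k<u_{k+1}<\cdots<u_s$ for some $1\le k\le s$. Let $\mathbf B_n(\lambda/\mu)$ be the set of tableaux $T$ of shifted shape $\lambda/\mu$ with entries in $[n]=\{1<\cdots<n\}$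 such that every nonempty row $T^{(k)}$ is a hook word and, for $1\le k<\ell(\lambda)$ and $1\le i\le j\le\lambda_{k+1}$, * (S1) if $T(k,i)\le T(k+1,j)$, then $i\ne 1$ and $T(k+1,i-1)<T(k+1,j)$; * (S2) if $T(k,i)>T(k+1,j)$, then $T(k,i)\ge T(k,j+1)$, where an inequality involving an empty entry counts as false. *$\mathfrak q(n)$-crystals.* Let $P=\bigoplus_{k=1}^n\mathbb Z\epsilon_k$, $\langle x,h_i\rangle=x_i-x_{i+1}$ for $x=\sum_k x_k\epsilon_k\in P$, $\alpha_i=\epsilon_i-\epsilon_{i+1}$ and $I=\{1,\dots,n-1,\overline 1\}$. A $\mathfrak q(n)$-crystal is a set $B$ with maps ${\rm wt}:B\to P$, $\varepsilon_i,\varphi_i:B\to\mathbb Z\cup\{-\infty\}$ $(1\le i\le n-1)$ and $\tilde e_i,\tilde f_i:B\to B\cup\{\mathbf 0\}$ $(i\in I)$ such that for all $b,b'\in B$ and $1\le i\le n-1$: $\varphi_i(b)=\langle{\rm wt}(b),h_i\rangle+\varepsilon_i(b)$; if $\tilde e_ib\ne\mathbf 0$, then $\varepsilon_i,\varphi_i,{\rm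 wt}$ change by $-1,+1,+\alpha_i$ under $\tilde e_i$, and if $\tilde f_ib\neq\mathbf 0$, they change by $+1,-1,-\alpha_i$ under $\tilde f_i$; $\tilde f_ib=b'$ if and only if $\tilde e_ib'=b$; $\tilde e_ib=\tilde f_ib=\mathbf 0$ if $\varphi_i(b)=-\infty$; ${\rm wt}(b)\in\bigoplus_k\mathbb Z_{\ge0}\epsilon_k$; $\tilde e_{\overline1}$ and $\tilde f_{\overline1}$, where nonzero, change ${\rm wt}$ by $+\alpha_1$ and $-\alpha_1$; $\tilde f_{\overline1}b=b'$ if and only if $\tilde e_{\overline1}b'=b$; and for $3\le i\le n-1$, $\tilde e_{\overline1},\tilde f_{\overline1}$ commute with $\tilde e_i,\tilde f_i$ (all fixing $\mathbf 0$), and $\varepsilon_i,\varphi_i$ are unchanged by $\tilde e_{\overline 1}$ where it is nonzero. *The maps on words.* Let $\mathcal W_{[n]}$ be the set of finite words in $[n]$. A letter $k$ has weight $\epsilon_k$; on letters $\tilde f_i$ sends $i$ to $i+1$, $\tilde e_i$ sends $i+1$ to $i$, all other values are $\mathbf 0$, $\tilde f_{\overline1}=\tilde f_1$, $\tilde e_{\overline1}=\tilde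 e_1$, $\varphi_i(k)=\delta_{k,i}$ and $\varepsilon_i(k)=\delta_{k,i+1}$. A word $aw$ with first letter $a$ is identified with $a\otimes w$; the empty word has ${\rm wt}=\varepsilon_i=\varphi_i=0$ and $\tilde e_i=\tilde f_i=\mathbf 0$ for all $i \in I$. Here ${\rm wt}(a\otimes w)={\rm wt}(a)+{\rm wt}(w)$ and, for $1\le i\le n-1$, $$\varepsilon_i(a\otimes w)=\max\{\varepsilon_i(a),\varepsilon_i(w)-\langle{\rm wt}(a),h_i\rangle\},\qquad \varphi_i(a\otimes w)=\max\{\varphi_i(a)+\langle{\rm wt}(w),h_i\rangle,\varphi_i(w)\};$$ $\tilde e_i(a\otimes w)$ is $\tilde e_ia\otimes w$ if $\varphi_i(a)\ge\varepsilon_i(w)$ and $a\otimes\tilde e_iw$ otherwise; $\tilde f_i(a\otimes w)$ is $\tilde f_ia\otimes w$ if $\varphi_i(a)>\varepsilon_i(w)$ and $a\otimes\tilde f_iw$ otherwise; and $\tilde e_{\overline1},\tilde f_{\overline1}$ act on $a$ if neither $1$ nor $2$ occurs in $w$, and on $w$ otherwise ($\mathbf 0\otimes w=a\otimes\mathbf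 0=\mathbf 0$). **Proposition.** The map $\mathbf B_n(\lambda/\mu)\to\mathcal W_{[n]}$, $T\mapsto w_{\rm rev}(T)$, is injective, and its image together with $\{\mathbf 0\}$ is invariant under $\tilde e_i$ and $\tilde f_i$ for all $i\in I$. Hence $\mathbf B_n(\lambda/\mu)$ is a $\mathfrak q(n)$-crystal with respect to the maps ${\rm wt},\varepsilon_i,\varphi_i,\tilde e_i,\tilde f_i$ induced from $\mathcal W_{[n]}$ through $w_{\rm rev}$. -/

import Mathlib

/-! # Skew semistandard decomposition tableaux and `q(n)`-crystals

Letters `1, …, n` and the crystal indices `1, …, n - 1` keep their usual names.  Rows of a diagram,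
and the diagonals in it, are numbered from `0`.  The formal symbol `0` of crystal theory is `none`. -/

namespace SkewSSDT

/-! ## Strict partitions and shifted diagrams -/

/-- Strict partitions `(part 0 ≥ part 1 ≥ ⋯)`: equal consecutive parts vanish. -/
structure StrictPartition where
  part : ℕ → ℕ
  part_succ_le : ∀ i, part (i + 1) ≤ part i
  eq_zero_of_eq : ∀ i, part i = part (i + 1) → part i = 0
  finite_support : (Function.support part).Finite

/-- The length: the number of nonzero parts. -/
noncomputable def StrictPartition.length (lam : StrictPartition) : ℕ :=
  (Function.support lam.part).ncard

/-- The shifted diagram: row `p` occupies the columns `p, …, p + part p - 1`. -/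
def StrictPartition.shiftedDiagram (lam : StrictPartition) : Set (ℕ × ℕ) :=
  {x | x.1 ≤ x.2 ∧ x.2 < x.1 + lam.part x.1}

/-! ## Tableaux of shifted skew shape and their words -/

/-- Tableaux of shifted shape `lam / mu` with entries in `A`: arbitrary fillings. -/
abbrev SkewTableau (lam mu : StrictPartition) (A : Type*) : Type _ :=
  ↥(lam.shiftedDiagram \ mu.shiftedDiagram) → A

section Tableau

variable {lam mu : StrictPartition} {A : Type*}

/-- The box in row `p` on the `q`-th diagonal from the main one is `(p, p + q)`. -/
theorem box_mem {p q : ℕ} (h : mu.part p ≤ q ∧ q < lam.part p) :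
    (p, p + q) ∈ lam.shiftedDiagram \ mu.shiftedDiagram := by
  refine ⟨⟨Nat.le_add_right p q, Nat.add_lt_add_left h.2 p⟩, fun hm => ?_⟩
  exact absurd (Nat.lt_of_add_lt_add_left hm.2) (not_lt.mpr h.1)

/-- `T.entry p q`, the entry of `T` in row `p` on the `q`-th diagonal, i.e. in the box `(p, p + q)`;
it is `none` (empty) if this box is not in the skew diagram. -/
def SkewTableau.entry (T : SkewTableau lam mu A) (p q : ℕ) : Option A :=
  if h : mu.part p ≤ q ∧ q < lam.part p then some (T ⟨(p, p + q), box_mem h⟩) else none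

/-- The word of row `p`, read from left to right. -/
def SkewTableau.row (T : SkewTableau lam mu A) (p : ℕ) : List A :=
  (List.range (lam.part p)).filterMap (SkewTableau.entry T p)

/-- The reading word: rows from top to bottom, each row from right to left. -/
noncomputable def SkewTableau.word (T : SkewTableau lam mu A) : List A :=
  (List.range lam.length).flatMap fun p => (SkewTableau.row T p).reverse

/-- The reversed reading word. -/
noncomputable def SkewTableau.revWord (T : SkewTableau lam mu A) : List A :=
  (SkewTableau.word T).reverse

variable [LinearOrder A]

/-- Hook words `u₁ ≥ ⋯ ≥ u_k < u_{k+1} < ⋯ < u_s` with `1 ≤ k ≤ s`; here `u_k` is `x`. -/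
def IsHookWord (u : List A) : Prop :=
  ∃ (d : List A) (x : A) (r : List A), u = d ++ x :: r ∧
    (d ++ [x]).Pairwise (fun a b => a ≥ b) ∧ (x :: r).Pairwise (fun a b => a < b)

/-- Skew semistandard decomposition tableaux.  Each (nonempty) row is a hook word, and the entries
satisfy the two conditions relating consecutive rows; an inequality with an empty entry counts as
false.  (For `j < lam.part (k + 1)`, row `k + 1` is automatically one of the rows of `lam`.) -/
structure SkewTableau.IsSkewSSDT (T : SkewTableau lam mu A) : Prop where
  hook : ∀ k, SkewTableau.row T k ≠ [] → IsHookWord (SkewTableau.row T k)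
  /-- If `T(k, i) ≤ T(k + 1, j)`, then `i` is not the main diagonal and
  `T(k + 1, i - 1) < T(k + 1, j)`. -/
  cond_one : ∀ k i j, i ≤ j → j < lam.part (k + 1) →
    ∀ a ∈ SkewTableau.entry T k i, ∀ b ∈ SkewTableau.entry T (k + 1) j, a ≤ b →
      i ≠ 0 ∧ ∃ c ∈ SkewTableau.entry T (k + 1) (i - 1), c < b
  /-- If `T(k, i) > T(k + 1, j)`, then `T(k, i) ≥ T(k, j + 1)`. -/
  cond_two : ∀ k i j, i ≤ j → j < lam.part (k + 1) →
    ∀ a ∈ SkewTableau.entry T k i, ∀ b ∈ SkewTableau.entry T (k + 1) j, a > b →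
      ∃ c ∈ SkewTableau.entry T k (j + 1), a ≥ c

end Tableau

/-! ## Weights, indices and `q(n)`-crystals -/

/-- The alphabet `[n] = {1 < 2 < ⋯ < n}`. -/
abbrev Letter (n : ℕ) : Type := {k : ℕ // 1 ≤ k ∧ k ≤ n}

/-- The set `B_n(lam / mu)` of skew semistandard decomposition tableaux with entries in `[n]`. -/
def skewB (n : ℕ) (lam mu : StrictPartition) : Set (SkewTableau lam mu (Letter n)) :=
  {T | SkewTableau.IsSkewSSDT T}

/-- The weight lattice `⊕ ℤ ε_k` (`1 ≤ k ≤ n`). -/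
abbrev Weight (n : ℕ) : Type := Letter n → ℤ

/-- The coefficient of `ε_i` in a weight (`0` if `i` is not in `[n]`). -/
def Weight.coeff {n : ℕ} (x : Weight n) (i : ℕ) : ℤ :=
  if h : 1 ≤ i ∧ i ≤ n then x ⟨i, h⟩ else 0

/-- The pairing `⟨x, h_i⟩` with the simple coroot `h_i = e_i - e_{i+1}`. -/
def Weight.pairing {n : ℕ} (x : Weight n) (i : ℕ) : ℤ :=
  Weight.coeff x i - Weight.coeff x (i + 1)

/-- The fundamental weight vector `ε_i`. -/
def eps (n i : ℕ) : Weight n := fun k => if k.1 = i then 1 else 0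

/-- The simple root `α_i = ε_i - ε_{i+1}`. -/
def simpleRoot (n i : ℕ) : Weight n := eps n i - eps n (i + 1)

/-- The `gl(n)` part `{1, …, n - 1}` of the index set. -/
abbrev GlIndex (n : ℕ) : Type := {i : ℕ // 1 ≤ i ∧ i < n}

/-- The index set `I = {1, …, n - 1, 1̄}`. -/
inductive QIndex (n : ℕ) : Type
  | gl (i : GlIndex n) : QIndex n
  | bar : QIndex n

/-- The maps of a crystal; `none` in the values of `e` and `f` is the formal symbol `0`. -/
structure CrystalData (n : ℕ) (B : Type*) where
  wt : B → Weight n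
  ε : GlIndex n → B → WithBot ℤ
  φ : GlIndex n → B → WithBot ℤ
  e : QIndex n → B → Option B
  f : QIndex n → B → Option B

/-- The axioms of a `gl(n)`-crystal. -/
structure CrystalData.IsGlCrystal {n : ℕ} {B : Type*} (C : CrystalData n B) : Prop where
  phi_eq : ∀ (i : GlIndex n) (b : B),
    C.φ i b = ((Weight.pairing (C.wt b) i.1 : ℤ) : WithBot ℤ) + C.ε i b
  e_spec : ∀ (i : GlIndex n) (b b' : B), C.e (.gl i) b = some b' →
    C.ε i b' = C.ε i b + ((-1 : ℤ) : WithBot ℤ) ∧ C.φ i b' = C.φ i b + ((1 : ℤ) : WithBot ℤ) ∧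
      C.wt b' = C.wt b + simpleRoot n i.1
  f_spec : ∀ (i : GlIndex n) (b b' : B), C.f (.gl i) b = some b' →
    C.ε i b' = C.ε i b + ((1 : ℤ) : WithBot ℤ) ∧ C.φ i b' = C.φ i b + ((-1 : ℤ) : WithBot ℤ) ∧
      C.wt b' = C.wt b - simpleRoot n i.1
  f_iff_e : ∀ (i : GlIndex n) (b b' : B), C.f (.gl i) b = some b' ↔ C.e (.gl i) b' = some b
  eq_none_of_bot : ∀ (i : GlIndex n) (b : B), C.φ i b = ⊥ →
    C.e (.gl i) b = none ∧ C.f (.gl i) b = none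

/-- The axioms of a `q(n)`-crystal.  Commutation is that of maps `B ∪ {0} → B ∪ {0}` fixing `0`. -/
structure CrystalData.IsQCrystal {n : ℕ} {B : Type*} (C : CrystalData n B) : Prop
    extends C.IsGlCrystal where
  wt_nonneg : ∀ (b : B) (k : Letter n), 0 ≤ C.wt b k
  wt_e_bar : ∀ b b' : B, C.e .bar b = some b' → C.wt b' = C.wt b + simpleRoot n 1
  wt_f_bar : ∀ b b' : B, C.f .bar b = some b' → C.wt b' = C.wt b - simpleRoot n 1
  f_bar_iff_e_bar : ∀ b b' : B, C.f .bar b = some b' ↔ C.e .bar b' = some b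
  e_bar_comm_e : ∀ i : GlIndex n, 3 ≤ i.1 → ∀ b : B,
    (C.e (.gl i) b).bind (C.e .bar) = (C.e .bar b).bind (C.e (.gl i))
  e_bar_comm_f : ∀ i : GlIndex n, 3 ≤ i.1 → ∀ b : B,
    (C.f (.gl i) b).bind (C.e .bar) = (C.e .bar b).bind (C.f (.gl i))
  f_bar_comm_e : ∀ i : GlIndex n, 3 ≤ i.1 → ∀ b : B,
    (C.e (.gl i) b).bind (C.f .bar) = (C.f .bar b).bind (C.e (.gl i))
  f_bar_comm_f : ∀ i : GlIndex n, 3 ≤ i.1 → ∀ b : B,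
    (C.f (.gl i) b).bind (C.f .bar) = (C.f .bar b).bind (C.f (.gl i))
  e_bar_string : ∀ i : GlIndex n, 3 ≤ i.1 → ∀ b b' : B, C.e .bar b = some b' →
    C.ε i b' = C.ε i b ∧ C.φ i b' = C.φ i b

/-! ## The crystal of words

A word `a :: w` is the tensor product `a ⊗ w`, and the empty word spans the trivial crystal. -/

/-- On letters, `e_i` sends `i + 1` to `i` and everything else to `0`
(`e_1̄` is the case `i = 1`). -/
def letterE {n : ℕ} (i : ℕ) (a : Letter n) : Option (Letter n) :=
  if h : 1 ≤ i ∧ a.1 = i + 1 then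
    some ⟨i, h.1, by have := a.2.2; omega⟩ else none

/-- On letters, `f_i` sends `i` to `i + 1` and everything else to `0`
(`f_1̄` is the case `i = 1`). -/
def letterF {n : ℕ} (i : ℕ) (a : Letter n) : Option (Letter n) :=
  if h : a.1 = i ∧ i + 1 ≤ n then some ⟨i + 1, Nat.le_add_left 1 i, h.2⟩ else none

/-- `ε_i` of a letter. -/
def letterEps {n : ℕ} (i : ℕ) (a : Letter n) : ℤ := if a.1 = i + 1 then 1 else 0

/-- `φ_i` of a letter. -/
def letterPhi {n : ℕ} (i : ℕ) (a : Letter n) : ℤ := if a.1 = i then 1 else 0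

/-- `wt(a ⊗ w) = wt(a) + wt(w)`. -/
def wordWt {n : ℕ} : List (Letter n) → Weight n
  | [] => 0
  | a :: w => eps n a.1 + wordWt w

/-- `ε_i(a ⊗ w) = max {ε_i(a), ε_i(w) - ⟨wt(a), h_i⟩}`. -/
def wordEps {n : ℕ} (i : ℕ) : List (Letter n) → ℤ
  | [] => 0
  | a :: w => max (letterEps i a) (wordEps i w - Weight.pairing (eps n a.1) i)

/-- `φ_i(a ⊗ w) = max {φ_i(a) + ⟨wt(w), h_i⟩, φ_i(w)}`. -/
def wordPhi {n : ℕ} (i : ℕ) : List (Letter n) → ℤ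
  | [] => 0
  | a :: w => max (letterPhi i a + Weight.pairing (wordWt w) i) (wordPhi i w)

/-- `e_i(a ⊗ w)` is `e_i a ⊗ w` if `φ_i(a) ≥ ε_i(w)`, and `a ⊗ e_i w` otherwise. -/
def wordE {n : ℕ} (i : ℕ) : List (Letter n) → Option (List (Letter n))
  | [] => none
  | a :: w =>
    if letterPhi i a ≥ wordEps i w then (letterE i a).map (fun a' => a' :: w)
    else (wordE i w).map (fun w' => a :: w')

/-- `f_i(a ⊗ w)` is `f_i a ⊗ w` if `φ_i(a) > ε_i(w)`, and `a ⊗ f_i w` otherwise. -/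
def wordF {n : ℕ} (i : ℕ) : List (Letter n) → Option (List (Letter n))
  | [] => none
  | a :: w =>
    if letterPhi i a > wordEps i w then (letterF i a).map (fun a' => a' :: w)
    else (wordF i w).map (fun w' => a :: w')

/-- `e_1̄(a ⊗ w)` is `e_1̄ a ⊗ w` if `ε_1`, `ε_2` do not occur in `wt(w)`, and `a ⊗ e_1̄ w`
otherwise. -/
def wordEBar {n : ℕ} : List (Letter n) → Option (List (Letter n))
  | [] => none
  | a :: w =>
    if Weight.coeff (wordWt w) 1 = 0 ∧ Weight.coeff (wordWt w) 2 = 0 then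
      (letterE 1 a).map (fun a' => a' :: w)
    else (wordEBar w).map (fun w' => a :: w')

/-- `f_1̄(a ⊗ w)` is `f_1̄ a ⊗ w` if `ε_1`, `ε_2` do not occur in `wt(w)`, and `a ⊗ f_1̄ w`
otherwise. -/
def wordFBar {n : ℕ} : List (Letter n) → Option (List (Letter n))
  | [] => none
  | a :: w =>
    if Weight.coeff (wordWt w) 1 = 0 ∧ Weight.coeff (wordWt w) 2 = 0 then
      (letterF 1 a).map (fun a' => a' :: w)
    else (wordFBar w).map (fun w' => a :: w')

/-- The `q(n)`-crystal maps on the set of words with letters in `[n]`. -/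
def wordCrystal (n : ℕ) : CrystalData n (List (Letter n)) where
  wt := wordWt
  ε i w := ((wordEps i.1 w : ℤ) : WithBot ℤ)
  φ i w := ((wordPhi i.1 w : ℤ) : WithBot ℤ)
  e
    | .gl i => wordE i.1
    | .bar => wordEBar
  f
    | .gl i => wordF i.1
    | .bar => wordFBar

end SkewSSDT

open SkewSSDT

namespace SkewSSDT

/-! ## Hook subwords and elementary moves -/

/-! A filling of the skew shape is completed to one of the straight shape by writing `n + mu.part p`
in all removed boxes of row `p`. These letters exceed `n`, are constant along rows and strictly
decrease from row to row. As a result the conventions on empty entries turn into ordinary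
inequalities (`isHook_padded_iff`, `rowsCompatible_padded_iff`).

For a straight shape whose rows are hook words, the two conditions on consecutive rows say exactly
that no hook subword of (row `k + 1`)(row `k`) is longer than row `k` (`RowsCompatible.length_le`,
`RowsCompatible.of_length_le`). Being a tableau is therefore a statement about the lengths of hook
subwords in two kinds of factors of the reversed reading word: single rows and pairs of adjacent
rows.

A crystal operator replaces a single letter. For `e_i`, `f_i` the signature rule makes the
surroundings of that letter balanced in `i` and `i + 1`; for the barred operators only letters other
than `1` and `2` follow it. In both cases every hook subword can be traded for one of the same
length after the replacement (`Move.exists_hook`). This passes to factors (`exists_hook_of_infix`),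
and letters above `n` do not interfere (`Move.of_filter`), so tableaux go to tableaux
(`exists_tableau_of_move`).

Injectivity only uses that the shape fixes which box each letter of the word comes from. The crystal
axioms are proved once on all words and restricted to the stable image
(`CrystalData.IsQCrystal.induced`). -/

/-- A weakly decreasing word followed by a strictly increasing one. -/
def IsHook (u : List ℕ) : Prop :=
  ∃ d r : List ℕ, u = d ++ r ∧ d.Pairwise (fun a b => b ≤ a) ∧ r.Pairwise (fun a b => a < b)

theorem IsHook.sublist {u v : List ℕ} (hv : IsHook v) (h : u.Sublist v) : IsHook u := by
  obtain ⟨d, r, rfl, hd, hr⟩ := hv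
  obtain ⟨d', r', rfl, hd', hr'⟩ := List.sublist_append_iff.1 h
  exact ⟨d', r', rfl, hd.sublist hd', hr.sublist hr'⟩

/-- In `A ++ x :: B` with `x ∈ {i, i + 1}`, the letter `x` is the one on which `f_i` or `e_i`
acts. -/
def Balanced (i : ℕ) (A B : List ℕ) : Prop :=
  (∀ S, S <:+ A → S.count i ≤ S.count (i + 1)) ∧ ∀ S, S <+: B → S.count (i + 1) ≤ S.count i

theorem Balanced.of_append {i : ℕ} {A₀ A B B₀ : List ℕ} (h : Balanced i (A₀ ++ A) (B ++ B₀)) :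
    Balanced i A B :=
  ⟨fun S hS => h.1 S (hS.trans (List.suffix_append _ _)),
    fun S hS => h.2 S (hS.trans (List.prefix_append _ _))⟩

theorem exists_replicate_of_decreasing (i : ℕ) (s : List ℕ)
    (hs : s.Pairwise (fun a b => b ≤ a)) (h : ∀ a ∈ s, i ≤ a) :
    ∃ t k, s = t ++ List.replicate k i ∧ ∀ a ∈ t, i + 1 ≤ a := by
  induction s with
  | nil => exact ⟨[], 0, rfl, by simp⟩
  | cons a s ih =>
    rw [List.pairwise_cons] at hs
    obtain ⟨t, k, rfl, ht⟩ := ih hs.2 (fun b hb => h b (List.mem_cons_of_mem _ hb))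
    rcases Nat.lt_or_ge i a with ha | ha
    · refine ⟨a :: t, k, rfl, ?_⟩
      simpa using ⟨ha, ht⟩
    · have hai : a = i := le_antisymm ha (h a List.mem_cons_self)
      subst hai
      have : t = [] := by
        rcases t with _ | ⟨b, t⟩
        · rfl
        · have h1 := hs.1 b (by simp)
          have h2 := ht b (by simp)
          omega
      subst this
      exact ⟨[], k + 1, by simp [List.replicate_succ], by simp⟩

theorem exists_replicate_of_decreasing' (i : ℕ) (s : List ℕ)
    (hs : s.Pairwise (fun a b => b ≤ a)) (h : ∀ a ∈ s, a ≤ i + 1) :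
    ∃ k t, s = List.replicate k (i + 1) ++ t ∧ ∀ a ∈ t, a ≤ i := by
  induction s with
  | nil => exact ⟨0, [], rfl, by simp⟩
  | cons a s ih =>
    rw [List.pairwise_cons] at hs
    rcases Nat.lt_or_ge i a with ha | ha
    · obtain ⟨k, t, rfl, ht⟩ := ih hs.2 (fun b hb => h b (List.mem_cons_of_mem _ hb))
      have hai : a = i + 1 := le_antisymm (h a List.mem_cons_self) ha
      subst hai
      exact ⟨k + 1, t, by simp [List.replicate_succ], ht⟩
    · refine ⟨0, a :: s, by simp, ?_⟩
      simp only [List.mem_cons, forall_eq_or_imp]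
      exact ⟨ha, fun b hb => (hs.1 b hb).trans ha⟩

/-- If the subword uses the changed letter, only the `k` letters `i` just before it obstruct. They
come from a suffix of `A`, which by balance contains at least `k` letters `i + 1` to use instead. -/
theorem exists_decreasing_up {i : ℕ} {A B : List ℕ} (h : Balanced i A B) {s : List ℕ}
    (hs : s.Pairwise (fun a b => b ≤ a)) (hsub : s.Sublist (A ++ i :: B)) :
    ∃ s' : List ℕ, s'.Pairwise (fun a b => b ≤ a) ∧ s'.Sublist (A ++ (i + 1) :: B) ∧
      s'.length = s.length := by
  obtain ⟨s₁, s₂, rfl, h₁, h₀⟩ := List.sublist_append_iff.1 hsub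
  rcases List.sublist_cons_iff.1 h₀ with h₂ | ⟨s₂, rfl, h₂⟩
  · exact ⟨_, hs, h₁.append (h₂.cons _), rfl⟩
  · rw [List.pairwise_append, List.pairwise_cons] at hs
    obtain ⟨hs₁, ⟨hi₂, hs₂⟩, h₁₂⟩ := hs
    obtain ⟨t, k, rfl, ht⟩ := exists_replicate_of_decreasing i s₁ hs₁
      (fun a ha => h₁₂ a ha i (by simp))
    obtain ⟨A₁, A₂, rfl, hA₁, hA₂⟩ := List.append_sublist_iff.1 h₁
    refine ⟨(t ++ List.replicate k (i + 1)) ++ (i + 1) :: s₂, ?_, ?_, by simp⟩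
    · rw [List.pairwise_append] at hs₁
      simp only [List.pairwise_append, List.pairwise_cons, List.mem_replicate, List.mem_append,
        List.mem_cons]
      refine ⟨⟨hs₁.1, by simp, ?_⟩, ⟨?_, hs₂⟩, ?_⟩
      · rintro a ha b ⟨-, rfl⟩; exact ht a ha
      · intro b hb; exact (hi₂ b hb).trans (Nat.le_succ i)
      · rintro a (ha | ⟨-, rfl⟩) b (rfl | hb)
        · exact ht a ha
        · exact (hi₂ b hb).trans ((Nat.le_succ i).trans (ht a ha))
        · exact le_rfl
        · exact (hi₂ b hb).trans (Nat.le_succ i)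
    · refine (hA₁.append ?_).append (h₂.cons_cons _)
      rw [List.replicate_sublist_iff] at hA₂ ⊢
      exact hA₂.trans (h.1 _ (List.suffix_append _ _))

/-- Mirror image of `exists_decreasing_up`: the letters `i + 1` just after the changed letter lie in
a prefix of `B`, where balance supplies as many letters `i`. -/
theorem exists_decreasing_down {i : ℕ} {A B : List ℕ} (h : Balanced i A B) {s : List ℕ}
    (hs : s.Pairwise (fun a b => b ≤ a)) (hsub : s.Sublist (A ++ (i + 1) :: B)) :
    ∃ s' : List ℕ, s'.Pairwise (fun a b => b ≤ a) ∧ s'.Sublist (A ++ i :: B) ∧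
      s'.length = s.length := by
  obtain ⟨s₁, s₂, rfl, h₁, h₀⟩ := List.sublist_append_iff.1 hsub
  rcases List.sublist_cons_iff.1 h₀ with h₂ | ⟨s₂, rfl, h₂⟩
  · exact ⟨_, hs, h₁.append (h₂.cons _), rfl⟩
  · rw [List.pairwise_append, List.pairwise_cons] at hs
    obtain ⟨hs₁, ⟨hi₂, hs₂⟩, h₁₂⟩ := hs
    obtain ⟨k, t, rfl, ht⟩ := exists_replicate_of_decreasing' i s₂ hs₂ hi₂
    obtain ⟨B₁, B₂, rfl, hB₁, hB₂⟩ := List.append_sublist_iff.1 h₂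
    refine ⟨s₁ ++ i :: (List.replicate k i ++ t), ?_, ?_, by simp⟩
    · rw [List.pairwise_append] at hs₂
      have h₁i : ∀ a ∈ s₁, i + 1 ≤ a := fun a ha => h₁₂ a ha _ (by simp)
      simp only [List.pairwise_append, List.pairwise_cons, List.mem_replicate, List.mem_append,
        List.mem_cons]
      refine ⟨hs₁, ⟨?_, by simp, hs₂.2.1, ?_⟩, ?_⟩
      · rintro b (⟨-, rfl⟩ | hb)
        · exact le_rfl
        · exact ht b hb
      · rintro a ⟨-, rfl⟩ b hb; exact ht b hb
      · rintro a ha b (rfl | ⟨-, rfl⟩ | hb)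
        · have := h₁i a ha; omega
        · have := h₁i a ha; omega
        · have := h₁i a ha; have := ht b hb; omega
    · refine h₁.append (List.Sublist.cons_cons _ (List.Sublist.append ?_ hB₂))
      rw [List.replicate_sublist_iff] at hB₁ ⊢
      exact hB₁.trans (h.2 _ (List.prefix_append _ _))

/-- The only obstruction is an `i + 1` directly after the changed letter in the subword. It lies in
a prefix of `B`, and by balance an `i` precedes an `i + 1` inside that prefix. This pair replaces
the old one, and the changed letter is dropped. -/
theorem exists_increasing_up {i : ℕ} {A B : List ℕ} (h : Balanced i A B) {s : List ℕ}
    (hs : s.Pairwise (fun a b => a < b)) (hsub : s.Sublist (A ++ i :: B)) :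
    ∃ s' : List ℕ, s'.Pairwise (fun a b => a < b) ∧ s'.Sublist (A ++ (i + 1) :: B) ∧
      s'.length = s.length := by
  obtain ⟨s₁, s₂, rfl, h₁, h₀⟩ := List.sublist_append_iff.1 hsub
  rcases List.sublist_cons_iff.1 h₀ with h₂ | ⟨s₂, rfl, h₂⟩
  · exact ⟨_, hs, h₁.append (h₂.cons _), rfl⟩
  · by_cases hmem : i + 1 ∈ s₂
    · refine ⟨s₁ ++ i :: s₂, hs, h₁.append (List.Sublist.cons _ ?_), rfl⟩
      rw [List.pairwise_append, List.pairwise_cons] at hs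
      obtain ⟨hs₁, ⟨hi₂, hs₂⟩, h₁₂⟩ := hs
      obtain ⟨p, q, rfl⟩ := List.append_of_mem hmem
      have hp : p = [] := by
        rcases p with _ | ⟨b, p⟩
        · rfl
        · have h1 := hi₂ b (by simp)
          have h2 := (List.pairwise_cons.1 hs₂).1 (i + 1) (by simp)
          omega
      subst hp
      rw [List.nil_append] at h₂ ⊢
      obtain ⟨B₁, B₂, rfl, hB₁, hB₂⟩ := List.cons_sublist_iff.1 h₂
      have hc := h.2 B₁ (List.prefix_append _ _)
      have hi : i ∈ B₁ := List.count_pos_iff.1 ((List.count_pos_iff.2 hB₁).trans_le hc)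
      obtain ⟨C, D, rfl⟩ := List.append_of_mem hi
      have hc' := h.2 (C ++ [i]) ⟨D ++ B₂, by simp⟩
      have hBB : [i, i + 1].Sublist (C ++ i :: D) := by
        by_cases hD : i + 1 ∈ D
        · exact (List.Sublist.cons_cons _ (List.singleton_sublist.2 hD)).trans
            (List.sublist_append_right _ _)
        -- With no `i + 1` to the right of the chosen `i`, the prefix ending at an `i + 1` of `C`
        -- must already contain an `i`.
        · have hC : i + 1 ∈ C := by simpa [hD] using hB₁
          obtain ⟨C₁, C₂, rfl⟩ := List.append_of_mem hC
          have := h.2 (C₁ ++ [i + 1]) ⟨C₂ ++ i :: D ++ B₂, by simp⟩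
          have hi' : i ∈ C₁ := by
            rw [← List.count_pos_iff]
            simp at this
            omega
          have h3 : [i, i + 1].Sublist (C₁ ++ (i + 1) :: C₂) :=
            (List.singleton_sublist.2 hi').append
              (List.Sublist.cons_cons _ (List.nil_sublist _))
          exact h3.trans (List.sublist_append_left _ _)
      exact hBB.append hB₂
    · refine ⟨s₁ ++ (i + 1) :: s₂, ?_, h₁.append (h₂.cons_cons _), by simp⟩
      rw [List.pairwise_append, List.pairwise_cons] at hs ⊢
      obtain ⟨hs₁, ⟨hi₂, hs₂⟩, h₁₂⟩ := hs
      have hi₂' : ∀ a ∈ s₂, i + 1 < a := fun a ha =>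
        lt_of_le_of_ne (hi₂ a ha) (fun he => hmem (he ▸ ha))
      refine ⟨hs₁, ⟨hi₂', hs₂⟩, fun a ha b hb => ?_⟩
      have h1 := h₁₂ a ha i (by simp)
      rcases List.mem_cons.1 hb with rfl | hb
      · omega
      · have := hi₂' b hb; omega

/-- The only obstruction is an `i` directly before the changed letter. The suffix of `A` starting at
that `i` has, by balance, an `i + 1` further right, which replaces the changed letter. -/
theorem exists_increasing_down {i : ℕ} {A B : List ℕ} (h : Balanced i A B) {s : List ℕ}
    (hs : s.Pairwise (fun a b => a < b)) (hsub : s.Sublist (A ++ (i + 1) :: B)) :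
    ∃ s' : List ℕ, s'.Pairwise (fun a b => a < b) ∧ s'.Sublist (A ++ i :: B) ∧
      s'.length = s.length := by
  obtain ⟨s₁, s₂, rfl, h₁, h₀⟩ := List.sublist_append_iff.1 hsub
  rcases List.sublist_cons_iff.1 h₀ with h₂ | ⟨s₂, rfl, h₂⟩
  · exact ⟨_, hs, h₁.append (h₂.cons _), rfl⟩
  · by_cases hmem : i ∈ s₁
    · refine ⟨s₁ ++ (i + 1) :: s₂, hs, ?_, rfl⟩
      have : s₁ ++ (i + 1) :: s₂ = (s₁ ++ [i + 1]) ++ s₂ := by simp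
      rw [this]
      have : A ++ i :: B = A ++ ([i] ++ B) := by simp
      rw [this]
      rw [← List.append_assoc]
      refine List.Sublist.append (List.Sublist.trans ?_ (List.sublist_append_left A [i])) h₂
      rw [List.pairwise_append, List.pairwise_cons] at hs
      obtain ⟨hs₁, ⟨hi₂, hs₂⟩, h₁₂⟩ := hs
      obtain ⟨p, q, rfl⟩ := List.append_of_mem hmem
      have hq : q = [] := by
        rcases q with _ | ⟨b, q⟩
        · rfl
        · have h1 := h₁₂ b (by simp) (i + 1) (by simp)
          have h2 := (List.pairwise_cons.1 (List.pairwise_append.1 hs₁).2.1).1 b (by simp)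
          omega
      subst hq
      obtain ⟨A₁, A₂, rfl, hA₁, hA₂⟩ := List.append_sublist_iff.1 h₁
      obtain ⟨C, D, rfl⟩ := List.append_of_mem (List.singleton_sublist.1 hA₂)
      have hc := h.1 (i :: D) ⟨A₁ ++ C, by simp⟩
      have hD : i + 1 ∈ D := by
        rw [← List.count_pos_iff]
        simp at hc
        omega
      rw [List.append_assoc]
      refine hA₁.append (List.Sublist.trans ?_ (List.sublist_append_right _ _))
      exact List.Sublist.cons_cons _ (List.singleton_sublist.2 hD)
    · refine ⟨s₁ ++ i :: s₂, ?_, h₁.append (h₂.cons_cons _), by simp⟩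
      rw [List.pairwise_append, List.pairwise_cons] at hs ⊢
      obtain ⟨hs₁, ⟨hi₂, hs₂⟩, h₁₂⟩ := hs
      have h₁' : ∀ a ∈ s₁, a < i := fun a ha =>
        lt_of_le_of_ne (Nat.lt_succ_iff.1 (h₁₂ a ha (i + 1) (by simp))) (fun he => hmem (he ▸ ha))
      refine ⟨hs₁, ⟨fun b hb => (Nat.lt_succ_self i).trans (hi₂ b hb), hs₂⟩, fun a ha b hb => ?_⟩
      have h1 := h₁' a ha
      rcases List.mem_cons.1 hb with rfl | hb
      · omega
      · have := hi₂ b hb; omega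

/-- The word `A ++ y :: B` arises from `A ++ x :: B` by one of the operators `e_i`, `f_i`, `e_1̄`,
`f_1̄`. -/
def Move (A B : List ℕ) (x y : ℕ) : Prop :=
  (∃ i, (x = i ∧ y = i + 1 ∨ x = i + 1 ∧ y = i) ∧ Balanced i A B) ∨
    ((x = 1 ∧ y = 2 ∨ x = 2 ∧ y = 1) ∧ 1 ∉ B ∧ 2 ∉ B)

theorem Move.symm {A B : List ℕ} {x y : ℕ} (h : Move A B x y) : Move A B y x := by
  rcases h with ⟨i, h, hb⟩ | ⟨h, hb⟩
  · exact .inl ⟨i, h.symm.imp And.symm And.symm, hb⟩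
  · exact .inr ⟨h.symm.imp And.symm And.symm, hb⟩

theorem Move.of_append {A₀ A B B₀ : List ℕ} {x y : ℕ} (h : Move (A₀ ++ A) (B ++ B₀) x y) :
    Move A B x y := by
  rcases h with ⟨i, h, hb⟩ | ⟨h, h1, h2⟩
  · exact .inl ⟨i, h, hb.of_append⟩
  · exact .inr ⟨h, fun h => h1 (by simp [h]), fun h => h2 (by simp [h])⟩

theorem Balanced.of_filter {i n : ℕ} (hi : i + 1 ≤ n) {A B : List ℕ}
    (h : Balanced i (A.filter (· ≤ n)) (B.filter (· ≤ n))) : Balanced i A B := by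
  have key : ∀ S : List ℕ, ∀ j ≤ n, (S.filter (· ≤ n)).count j = S.count j := fun S j hj =>
    List.count_filter (by simpa using hj)
  constructor
  · intro S hS
    have := h.1 _ (hS.filter (· ≤ n))
    rwa [key _ _ hi, key _ _ (by omega)] at this
  · intro S hS
    have := h.2 _ (hS.filter (· ≤ n))
    rwa [key _ _ hi, key _ _ (by omega)] at this

/-- Letters larger than `n` play no role. -/
theorem Move.of_filter {n : ℕ} {A B : List ℕ} {x y : ℕ} (hx : x ≤ n) (hy : y ≤ n)
    (h : Move (A.filter (· ≤ n)) (B.filter (· ≤ n)) x y) : Move A B x y := by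
  rcases h with ⟨i, h, hb⟩ | ⟨h, h1, h2⟩
  · exact .inl ⟨i, h, hb.of_filter (by omega)⟩
  · refine .inr ⟨h, fun h' => h1 ?_, fun h' => h2 ?_⟩ <;>
      exact List.mem_filter.2 ⟨h', by simp; omega⟩

/-- Cut the word so that the two monotone parts of the hook come from separate factors. The changed
letter lies in one of them, balance is inherited by that factor, and only one part has to be
exchanged. -/
theorem Balanced.exists_hook {i : ℕ} {A B : List ℕ} {x y : ℕ} (hb : Balanced i A B)
    (h : x = i ∧ y = i + 1 ∨ x = i + 1 ∧ y = i) {s : List ℕ} (hs : IsHook s)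
    (hsub : s.Sublist (A ++ x :: B)) :
    ∃ s', IsHook s' ∧ s'.Sublist (A ++ y :: B) ∧ s'.length = s.length := by
  obtain ⟨d, r, rfl, hd, hr⟩ := hs
  obtain ⟨W₁, W₂, hW, hW₁, hW₂⟩ := List.append_sublist_iff.1 hsub
  rcases List.append_eq_append_iff.1 hW with ⟨C, rfl, hC⟩ | ⟨C, rfl, hC⟩
  · rcases List.cons_eq_append_iff.1 hC with ⟨rfl, rfl⟩ | ⟨C, rfl, rfl⟩
    · have hb' : Balanced i [] B := Balanced.of_append (A₀ := A) (B₀ := []) (by simpa using hb)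
      have : ∃ s' : List ℕ, s'.Pairwise (fun a b => a < b) ∧ s'.Sublist ([] ++ y :: B) ∧
          s'.length = r.length := by
        rcases h with ⟨rfl, rfl⟩ | ⟨rfl, rfl⟩
        · exact exists_increasing_up hb' hr hW₂
        · exact exists_increasing_down hb' hr hW₂
      obtain ⟨r', h1, h2, h3⟩ := this
      exact ⟨d ++ r', ⟨d, r', rfl, hd, h1⟩, (by simpa using hW₁ : d.Sublist A).append h2,
        by simp [h3]⟩
    · have hb' : Balanced i A C := Balanced.of_append (A₀ := []) (B₀ := W₂) hb
      have : ∃ s' : List ℕ, s'.Pairwise (fun a b => b ≤ a) ∧ s'.Sublist (A ++ y :: C) ∧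
          s'.length = d.length := by
        rcases h with ⟨rfl, rfl⟩ | ⟨rfl, rfl⟩
        · exact exists_decreasing_up hb' hd hW₁
        · exact exists_decreasing_down hb' hd hW₁
      obtain ⟨d', h1, h2, h3⟩ := this
      exact ⟨d' ++ r, ⟨d', r, rfl, h1, hr⟩, by simpa using h2.append hW₂, by simp [h3]⟩
  · have hb' : Balanced i C B := Balanced.of_append (A₀ := W₁) (B₀ := []) (by simpa using hb)
    have : ∃ s' : List ℕ, s'.Pairwise (fun a b => a < b) ∧ s'.Sublist (C ++ y :: B) ∧
        s'.length = r.length := by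
      rw [hC] at hW₂
      rcases h with ⟨rfl, rfl⟩ | ⟨rfl, rfl⟩
      · exact exists_increasing_up hb' hr hW₂
      · exact exists_increasing_down hb' hr hW₂
    obtain ⟨r', h1, h2, h3⟩ := this
    exact ⟨d ++ r', ⟨d, r', rfl, hd, h1⟩, by simpa using hW₁.append h2, by simp [h3]⟩

/-- A `1` in the decreasing part is its last letter, since what follows is at least `3`; as a `2` it
can open the increasing part. A `1` in the increasing part is already its first letter. -/
theorem isHook_of_one_to_two {s₁ s₂ : List ℕ} (hpos : ∀ a ∈ s₁, 1 ≤ a)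
    (h₂ : ∀ b ∈ s₂, 3 ≤ b) (h : IsHook (s₁ ++ 1 :: s₂)) : IsHook (s₁ ++ 2 :: s₂) := by
  obtain ⟨d, r, he, hd, hr⟩ := h
  rcases List.append_eq_append_iff.1 he with ⟨C, rfl, hC⟩ | ⟨C, rfl, rfl⟩
  · rcases List.cons_eq_append_iff.1 hC with ⟨rfl, rfl⟩ | ⟨C, rfl, rfl⟩
    · refine ⟨s₁, 2 :: s₂, rfl, by simpa using hd, ?_⟩
      exact List.pairwise_cons.2 ⟨h₂, (List.pairwise_cons.1 hr).2⟩
    · rw [List.pairwise_append, List.pairwise_cons] at hd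
      have hC : C = [] := by
        rcases C with _ | ⟨b, C⟩
        · rfl
        · have h1 := h₂ b (by simp)
          have h2 := hd.2.1.1 b (by simp)
          omega
      subst hC
      exact ⟨s₁, 2 :: r, rfl, hd.1, List.pairwise_cons.2 ⟨h₂, hr⟩⟩
  · rw [List.pairwise_append, List.pairwise_cons] at hr
    have hC : C = [] := by
      rcases C with _ | ⟨b, C⟩
      · rfl
      · have h1 := hpos b (by simp)
        have h2 := hr.2.2 b (by simp) 1 (by simp)
        omega
    subst hC
    exact ⟨d, 2 :: s₂, by simp, hd, List.pairwise_cons.2 ⟨h₂, hr.2.1.2⟩⟩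

/-- The new case compared with `isHook_of_one_to_two` is a `1` before the `2` in the increasing
part: it moves to the end of the decreasing part. -/
theorem isHook_of_two_to_one {s₁ s₂ : List ℕ} (hpos : ∀ a ∈ s₁, 1 ≤ a)
    (h₂ : ∀ b ∈ s₂, 3 ≤ b) (h : IsHook (s₁ ++ 2 :: s₂)) : IsHook (s₁ ++ 1 :: s₂) := by
  have h₂' : ∀ b ∈ s₂, 1 < b := fun b hb => by have := h₂ b hb; omega
  obtain ⟨d, r, he, hd, hr⟩ := h
  rcases List.append_eq_append_iff.1 he with ⟨C, rfl, hC⟩ | ⟨C, rfl, rfl⟩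
  · rcases List.cons_eq_append_iff.1 hC with ⟨rfl, rfl⟩ | ⟨C, rfl, rfl⟩
    · refine ⟨s₁, 1 :: s₂, rfl, by simpa using hd, ?_⟩
      exact List.pairwise_cons.2 ⟨h₂', (List.pairwise_cons.1 hr).2⟩
    · rw [List.pairwise_append, List.pairwise_cons] at hd
      have hC : C = [] := by
        rcases C with _ | ⟨b, C⟩
        · rfl
        · have h1 := h₂ b (by simp)
          have h2 := hd.2.1.1 b (by simp)
          omega
      subst hC
      exact ⟨s₁, 1 :: r, rfl, hd.1, List.pairwise_cons.2 ⟨h₂', hr⟩⟩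
  · rw [List.pairwise_append, List.pairwise_cons] at hr
    have hC : ∀ b ∈ C, b = 1 := fun b hb => by
      have h1 := hpos b (by simp [hb])
      have h2 := hr.2.2 b hb 2 (by simp)
      omega
    refine ⟨d ++ C, 1 :: s₂, rfl, ?_, List.pairwise_cons.2 ⟨h₂', hr.2.1.2⟩⟩
    rw [List.pairwise_append]
    refine ⟨hd, hr.1.imp_of_mem fun {a b} ha hb _ => by rw [hC a ha, hC b hb], fun a ha b hb => ?_⟩
    rw [hC b hb]
    exact hpos a (by simp [ha])

/-- The lengths of the hook subwords are not changed by the crystal operators. -/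
theorem Move.exists_hook {A B : List ℕ} {x y : ℕ} (h : Move A B x y)
    (hA : ∀ a ∈ A, 1 ≤ a) (hB : ∀ b ∈ B, 1 ≤ b) {s : List ℕ} (hs : IsHook s)
    (hsub : s.Sublist (A ++ x :: B)) :
    ∃ s', IsHook s' ∧ s'.Sublist (A ++ y :: B) ∧ s'.length = s.length := by
  rcases h with ⟨i, h, hb⟩ | ⟨h, h1, h2⟩
  · exact hb.exists_hook h hs hsub
  · obtain ⟨s₁, s₂, rfl, hs₁, hs₀⟩ := List.sublist_append_iff.1 hsub
    rcases List.sublist_cons_iff.1 hs₀ with hs₂ | ⟨s₂, rfl, hs₂⟩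
    · exact ⟨_, hs, hs₁.append (hs₂.cons _), rfl⟩
    · have hpos : ∀ a ∈ s₁, 1 ≤ a := fun a ha => hA a (hs₁.subset ha)
      have h3 : ∀ b ∈ s₂, 3 ≤ b := fun b hb => by
        have hb' := hs₂.subset hb
        have h4 := hB b hb'
        have h5 : b ≠ 1 := fun he => h1 (he ▸ hb')
        have h6 : b ≠ 2 := fun he => h2 (he ▸ hb')
        omega
      refine ⟨s₁ ++ y :: s₂, ?_, hs₁.append (hs₂.cons_cons _), by simp⟩
      rcases h with ⟨rfl, rfl⟩ | ⟨rfl, rfl⟩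
      · exact isHook_of_one_to_two hpos h3 hs
      · exact isHook_of_two_to_one hpos h3 hs

/-! ## Two consecutive rows -/

/-- The word `f 0, …, f (m - 1)`. -/
def rowWord (f : ℕ → ℕ) (m : ℕ) : List ℕ := (List.range m).map f

theorem length_rowWord (f : ℕ → ℕ) (m : ℕ) : (rowWord f m).length = m := by
  simp [rowWord]

theorem isHook_rowWord_iff {f : ℕ → ℕ} {m : ℕ} :
    IsHook (rowWord f m) ↔ ∃ t ≤ m, (∀ a b, a < b → b < t → f b ≤ f a) ∧
      ∀ a b, t ≤ a → a < b → b < m → f a < f b := by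
  constructor
  · rintro ⟨d, r, he, hd, hr⟩
    have hm : m = d.length + r.length := by
      simpa [length_rowWord] using congrArg List.length he
    have hget : ∀ a (ha : a < m), (d ++ r)[a]'(by simp; omega) = f a := by
      intro a ha
      simp [← he, rowWord]
    refine ⟨d.length, by omega, fun a b hab hb => ?_, fun a b ha hab hb => ?_⟩
    · have := List.pairwise_iff_getElem.1 hd a b (by omega) hb hab
      rw [← hget a (by omega), ← hget b (by omega)]
      rwa [List.getElem_append_left (by omega), List.getElem_append_left (by omega)]
    · have := List.pairwise_iff_getElem.1 hr (a - d.length) (b - d.length) (by omega) (by omega)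
        (by omega)
      rw [← hget a (by omega), ← hget b (by omega)]
      rwa [List.getElem_append_right (by omega), List.getElem_append_right (by omega)]
  · rintro ⟨t, ht, hd, hr⟩
    refine ⟨(rowWord f m).take t, (rowWord f m).drop t, (List.take_append_drop _ _).symm, ?_, ?_⟩
    · rw [List.pairwise_iff_getElem]
      intro a b ha hb hab
      simp [rowWord] at ha hb ⊢
      exact hd a b hab (by omega)
    · rw [List.pairwise_iff_getElem]
      intro a b ha hb hab
      simp [rowWord] at ha hb ⊢
      exact hr _ _ (by omega) (by omega) (by omega)

theorem length_le_of_pairwise_lt {l : List ℕ} (h : l.Pairwise (· < ·)) {a b : ℕ}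
    (hl : ∀ x ∈ l, a ≤ x ∧ x < b) : l.length ≤ b - a := by
  have hn : l.Nodup := h.imp (fun h => Nat.ne_of_lt h)
  rw [← List.toFinset_card_of_nodup hn, ← Nat.card_Ico]
  refine Finset.card_le_card fun x hx => ?_
  simpa using hl x (by simpa using hx)

/-- The conditions relating two consecutive rows `u`, `v` of a tableau of straight shape, `v` being
of length `m`. -/
def RowsCompatible (u v : ℕ → ℕ) (m : ℕ) : Prop :=
  (∀ i j, i ≤ j → j < m → u i ≤ v j → i ≠ 0 ∧ v (i - 1) < v j) ∧
    ∀ i j, i ≤ j → j < m → v j < u i → u (j + 1) ≤ u i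

theorem exists_indices_of_sublist_rowWord {f : ℕ → ℕ} {m : ℕ} {s : List ℕ}
    (h : s.Sublist (rowWord f m)) :
    ∃ I : List ℕ, s = I.map f ∧ I.Pairwise (· < ·) ∧ ∀ i ∈ I, i < m := by
  obtain ⟨I, hI, rfl⟩ := List.sublist_map_iff.1 h
  exact ⟨I, rfl, List.pairwise_lt_range.sublist hI, fun i hi => List.mem_range.1 (hI.subset hi)⟩

/-- Were the subword too long, `J` would have at least `i` elements, hence some `x ≥ i - 1`. As `x <
j` and `v j ≤ v x`, this `x` lies in the decreasing part of `v`, so `v (i - 1) ≥ v x ≥ v j`, against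
the first condition. -/
theorem RowsCompatible.length_le_of_decreasing {u v : ℕ → ℕ} {m₁ m₂ : ℕ}
    (h : RowsCompatible u v m₂) (hv : IsHook (rowWord v m₂)) {J I : List ℕ} {i j : ℕ}
    (hJ : (J ++ [j]).Pairwise (· < ·)) (hJm : ∀ x ∈ J ++ [j], x < m₂)
    (hI : (i :: I).Pairwise (· < ·)) (hIm : ∀ x ∈ i :: I, x < m₁)
    (hd : ∀ x ∈ J, v j ≤ v x) (hij : u i ≤ v j) : (J ++ [j]).length + (i :: I).length ≤ m₁ := by
  by_contra! hlt
  obtain ⟨t, ht, hvd, hvi⟩ := isHook_rowWord_iff.1 hv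
  have hIl : (i :: I).length ≤ m₁ - i := length_le_of_pairwise_lt hI fun x hx => by
    refine ⟨?_, hIm x hx⟩
    rcases List.mem_cons.1 hx with rfl | hx
    · exact le_rfl
    · exact ((List.pairwise_cons.1 hI).1 x hx).le
  have hjm := hJm j (by simp)
  have him := hIm i (by simp)
  rw [List.pairwise_append] at hJ
  have hJj : ∀ x ∈ J, x < j := fun x hx => hJ.2.2 x hx j (by simp)
  have hJl : J.length ≤ j - 0 := length_le_of_pairwise_lt hJ.1 fun x hx => ⟨Nat.zero_le _, hJj x hx⟩
  simp only [List.length_append, List.length_cons, List.length_nil] at hlt hIl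
  obtain ⟨hi, hlt'⟩ := h.1 i j (by omega) hjm hij
  have : ∃ x ∈ J, i - 1 ≤ x := by
    by_contra! hc
    have : J.length ≤ (i - 1) - 0 :=
      length_le_of_pairwise_lt hJ.1 fun x hx => ⟨Nat.zero_le _, hc x hx⟩
    omega
  obtain ⟨x, hx, hix⟩ := this
  have hxj := hJj x hx
  have hvx := hd x hx
  have hxt : x < t := by
    by_contra! hc
    have := hvi x j hc hxj hjm
    omega
  rcases hix.eq_or_lt with he | hl
  · rw [he] at hlt'; omega
  · have := hvd (i - 1) x hl hxt
    omega

/-- The second condition gives `u (j + 1) ≤ u i`. Every index in `I` belongs to the increasing part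
of `u` and carries a letter above `u i`, so it exceeds `j + 1`. Then `I` has at most `m₁ - (j + 2)`
elements and `J` at most `j`; `m₂ < m₁` guarantees `j + 2 ≤ m₁`. -/
theorem RowsCompatible.length_le_of_increasing {u v : ℕ → ℕ} {m₁ m₂ : ℕ} (hm : m₂ < m₁)
    (h : RowsCompatible u v m₂) (hu : IsHook (rowWord u m₁)) {J I : List ℕ} {i j : ℕ}
    (hJ : (J ++ [j]).Pairwise (· < ·)) (hJm : ∀ x ∈ J ++ [j], x < m₂)
    (hI : (i :: I).Pairwise (· < ·)) (hIm : ∀ x ∈ i :: I, x < m₁)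
    (hr : ∀ x ∈ I, u i < u x) (hij : v j < u i) : (J ++ [j]).length + (i :: I).length ≤ m₁ := by
  by_contra! hlt
  obtain ⟨t, ht, hud, hui⟩ := isHook_rowWord_iff.1 hu
  have hIl : (i :: I).length ≤ m₁ - i := length_le_of_pairwise_lt hI fun x hx => by
    refine ⟨?_, hIm x hx⟩
    rcases List.mem_cons.1 hx with rfl | hx
    · exact le_rfl
    · exact ((List.pairwise_cons.1 hI).1 x hx).le
  have hjm := hJm j (by simp)
  have him := hIm i (by simp)
  rw [List.pairwise_append] at hJ
  have hJl : J.length ≤ j - 0 := length_le_of_pairwise_lt hJ.1 fun x hx =>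
    ⟨Nat.zero_le _, hJ.2.2 x hx j (by simp)⟩
  simp only [List.length_append, List.length_cons, List.length_nil] at hlt hIl
  have hle := h.2 i j (by omega) hjm hij
  have hI' : I.length ≤ m₁ - (j + 2) := by
    refine length_le_of_pairwise_lt (List.pairwise_cons.1 hI).2 fun x hx =>
      ⟨?_, hIm x (List.mem_cons_of_mem _ hx)⟩
    by_contra! hc
    have hix := (List.pairwise_cons.1 hI).1 x hx
    have hux := hr x hx
    have hxt : t ≤ x := by
      by_contra! hc'
      have := hud i x hix hc'
      omega
    rcases (Nat.lt_succ_iff.1 hc).eq_or_lt with he | hl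
    · rw [he] at hux; omega
    · have := hui x (j + 1) hxt hl (by omega)
      omega
  omega

/-- A row of a tableau is a hook subword of maximal length in the word of this row and the next
one. -/
theorem RowsCompatible.length_le {u v : ℕ → ℕ} {m₁ m₂ : ℕ} (hm : m₂ < m₁)
    (h : RowsCompatible u v m₂) (hu : IsHook (rowWord u m₁)) (hv : IsHook (rowWord v m₂))
    {s : List ℕ} (hs : IsHook s) (hsub : s.Sublist (rowWord v m₂ ++ rowWord u m₁)) :
    s.length ≤ m₁ := by
  obtain ⟨s₁, s₂, rfl, h₁, h₂⟩ := List.sublist_append_iff.1 hsub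
  obtain ⟨J, rfl, hJ, hJm⟩ := exists_indices_of_sublist_rowWord h₁
  obtain ⟨I, rfl, hI, hIm⟩ := exists_indices_of_sublist_rowWord h₂
  have hl₁ := h₁.length_le
  have hl₂ := h₂.length_le
  rw [length_rowWord] at hl₁ hl₂
  rcases List.eq_nil_or_concat J with rfl | ⟨J, j, rfl⟩
  · simpa using hl₂
  rcases I with _ | ⟨i, I⟩
  · simp at hl₁ ⊢; omega
  rw [List.concat_eq_append] at *
  have hlen : ((J ++ [j]).map v ++ (i :: I).map u).length
      = (J ++ [j]).length + (i :: I).length := by simp; omega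
  rw [hlen]
  obtain ⟨d, r, he, hd, hr⟩ := hs
  -- The comparison at the junction of the two rows locates the turn of the hook: after a weak
  -- descent all letters taken from `v` are in the decreasing part, after an ascent all letters
  -- taken from `u` are in the increasing part.
  by_cases hij : u i ≤ v j
  · refine h.length_le_of_decreasing hv hJ hJm hI hIm ?_ hij
    have key : ∀ C : List ℕ, d = (J ++ [j]).map v ++ C → ∀ x ∈ J, v j ≤ v x := by
      rintro C rfl x hx
      rw [List.pairwise_append] at hd
      have hd1 := hd.1
      rw [List.map_append, List.pairwise_append] at hd1
      exact hd1.2.2 (v x) (List.mem_map_of_mem hx) (v j) (by simp)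
    rcases List.append_eq_append_iff.1 he with ⟨C, h1, h2⟩ | ⟨C, h1, h2⟩
    · exact key C h1
    · rcases List.eq_nil_or_concat C with rfl | ⟨C, c, rfl⟩
      · exact key [] (by simpa using h1.symm)
      · exfalso
        rw [List.concat_eq_append] at *
        have hc : c = v j := by
          have := congrArg List.getLast? h1
          simpa using this.symm
        rw [h2, List.pairwise_append] at hr
        have := hr.2.2 c (by simp) (u i) (by simp)
        omega
  · push Not at hij
    refine h.length_le_of_increasing hm hu hJ hJm hI hIm ?_ hij
    have key : ∀ C : List ℕ, r = C ++ (i :: I).map u → ∀ x ∈ I, u i < u x := by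
      rintro C rfl x hx
      rw [List.pairwise_append, List.map_cons, List.pairwise_cons] at hr
      exact hr.2.1.1 (u x) (List.mem_map_of_mem hx)
    rcases List.append_eq_append_iff.1 he with ⟨C, h1, h2⟩ | ⟨C, h1, h2⟩
    · rcases C with _ | ⟨c, C⟩
      · exact key [] (by simpa using h2.symm)
      · exfalso
        have hc : c = u i := by simp at h2; exact h2.1.symm
        rw [h1, List.pairwise_append] at hd
        have := hd.2.2 (v j) (by simp) c (by simp)
        omega
    · exact key C h2

theorem rowWord_add (f : ℕ → ℕ) (a b : ℕ) :
    rowWord f (a + b) = rowWord f a ++ rowWord (fun k => f (a + k)) b := by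
  simp [rowWord, List.range_add, Function.comp_def]

theorem rowWord_succ (f : ℕ → ℕ) (a : ℕ) : rowWord f (a + 1) = rowWord f a ++ [f a] := by
  simp [rowWord, List.range_succ]

theorem mem_rowWord {f : ℕ → ℕ} {m a : ℕ} : a ∈ rowWord f m ↔ ∃ k < m, f k = a := by
  simp [rowWord]

theorem pairwise_rowWord {f : ℕ → ℕ} {m : ℕ} {R : ℕ → ℕ → Prop} :
    (rowWord f m).Pairwise R ↔ ∀ a b, a < b → b < m → R (f a) (f b) := by
  rw [List.pairwise_iff_getElem]
  constructor
  · intro h a b hab hb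
    simpa [rowWord] using h a b (by simp [rowWord]; omega) (by simpa [rowWord] using hb) hab
  · intro h a b ha hb hab
    simp [rowWord] at ha hb ⊢
    exact h a b hab hb

/-- If every row is a hook subword of maximal length in the word of this row and the next one, then
the rows are those of a tableau. -/
theorem RowsCompatible.of_length_le {u v : ℕ → ℕ} {m₁ m₂ : ℕ} (hm : m₂ < m₁)
    (hu : IsHook (rowWord u m₁)) (hv : IsHook (rowWord v m₂))
    (h : ∀ s, IsHook s → s.Sublist (rowWord v m₂ ++ rowWord u m₁) → s.length ≤ m₁) :
    RowsCompatible u v m₂ := by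
  obtain ⟨t, ht, hud, hui⟩ := isHook_rowWord_iff.1 hu
  obtain ⟨t', ht', hvd, hvi⟩ := isHook_rowWord_iff.1 hv
  -- Each final segment of `u` is a hook whose first letter may be counted in the decreasing part.
  have hudrop : ∀ i < m₁, ∃ d r : List ℕ, rowWord (fun k => u (i + k)) (m₁ - i) = u i :: d ++ r ∧
      (u i :: d).Pairwise (fun a b => b ≤ a) ∧ r.Pairwise (fun a b => a < b) := by
    intro i hi
    by_cases hit : i < t
    · refine ⟨rowWord (fun k => u (i + 1 + k)) (t - i - 1), rowWord (fun k => u (t + k)) (m₁ - t),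
        ?_, ?_, ?_⟩
      · obtain ⟨c, rfl⟩ := Nat.exists_eq_add_of_lt hit
        obtain ⟨e, rfl⟩ := Nat.exists_eq_add_of_le ht
        have h1 : i + c + 1 + e - i = 1 + (c + e) := by omega
        have h2 : i + c + 1 - i - 1 = c := by omega
        have h3 : i + c + 1 + e - (i + c + 1) = e := by omega
        rw [h1, h2, h3, rowWord_add, rowWord_add]
        simp only [rowWord, ← add_assoc]
        simp [add_assoc, add_comm]
        exact fun a _ => congrArg u (by omega)
      · rw [List.pairwise_cons]
        refine ⟨fun b hb => ?_, pairwise_rowWord.2 fun a b hab hb => hud _ _ (by omega) (by omega)⟩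
        obtain ⟨k, hk, rfl⟩ := mem_rowWord.1 hb
        exact hud _ _ (by omega) (by omega)
      · exact pairwise_rowWord.2 fun a b hab hb => hui _ _ (by omega) (by omega) (by omega)
    · refine ⟨[], rowWord (fun k => u (i + 1 + k)) (m₁ - i - 1), ?_, by simp, ?_⟩
      · obtain ⟨c, rfl⟩ := Nat.exists_eq_add_of_lt hi
        have h1 : i + c + 1 - i = 1 + c := by omega
        have h2 : i + c + 1 - i - 1 = c := by omega
        rw [h2, h1, rowWord_add]
        simp [rowWord, add_assoc]
      · exact pairwise_rowWord.2 fun a b hab hb => hui _ _ (by omega) (by omega) (by omega)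
  have hsubdrop : ∀ i ≤ m₁, (rowWord (fun k => u (i + k)) (m₁ - i)).Sublist (rowWord u m₁) := by
    intro i hi
    have : rowWord u m₁ = rowWord u i ++ rowWord (fun k => u (i + k)) (m₁ - i) := by
      rw [← rowWord_add, Nat.add_sub_cancel' hi]
    rw [this]
    exact List.sublist_append_right _ _
  have hsubtake : ∀ i ≤ m₂, ∃ w, rowWord v m₂ = rowWord v i ++ w ∧
      ∀ j, i ≤ j → j < m₂ → v j ∈ w := by
    intro i hi
    refine ⟨rowWord (fun k => v (i + k)) (m₂ - i), ?_, fun j hij hj => ?_⟩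
    · rw [← rowWord_add, Nat.add_sub_cancel' hi]
    · exact mem_rowWord.2 ⟨j - i, by omega, by rw [Nat.add_sub_cancel' hij]⟩
  constructor
  · intro i j hij hj hle
    by_contra! hc
    have hdec : ∀ k < i, v j ≤ v k ∧ ∀ l, k < l → l < i → v l ≤ v k := by
      intro k hk
      have hvj := hc (by omega)
      have hit : i - 1 < t' := by
        by_contra! hc'
        have := hvi (i - 1) j hc' (by omega) hj
        omega
      constructor
      · rcases (show k ≤ i - 1 by omega).eq_or_lt with rfl | hl
        · exact hvj
        · exact hvj.trans (hvd k (i - 1) hl hit)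
      · intro l hkl hl
        exact hvd k l hkl (by omega)
    obtain ⟨d, r, hdr, hd, hr⟩ := hudrop i (by omega)
    obtain ⟨w, hw, hwmem⟩ := hsubtake i (by omega)
    have hlen := congrArg List.length hdr
    -- If the first condition fails, `v 0, …, v (i - 1), v j, u i, …, u (m₁ - 1)` is a hook of
    -- length `m₁ + 1`.
    have := h ((rowWord v i ++ [v j]) ++ (u i :: d ++ r)) ?_ ?_
    · simp [length_rowWord] at this hlen
      omega
    · refine ⟨rowWord v i ++ [v j] ++ (u i :: d), r, by simp, ?_, hr⟩
      rw [List.pairwise_append, List.pairwise_append]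
      refine ⟨⟨pairwise_rowWord.2 fun a b hab hb => (hdec a (by omega)).2 b hab hb, by simp, ?_⟩,
        hd, ?_⟩
      · intro a ha b hb
        obtain ⟨k, hk, rfl⟩ := mem_rowWord.1 ha
        rw [List.mem_singleton.1 hb]
        exact (hdec k hk).1
      · intro a ha b hb
        have hb' : b ≤ u i := by
          rcases List.mem_cons.1 hb with rfl | hb
          · exact le_rfl
          · exact (List.pairwise_cons.1 hd).1 b hb
        have ha' : v j ≤ a := by
          rcases List.mem_append.1 ha with ha | ha
          · obtain ⟨k, hk, rfl⟩ := mem_rowWord.1 ha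
            exact (hdec k hk).1
          · rw [List.mem_singleton.1 ha]
        omega
    · rw [← hdr]
      refine List.Sublist.append ?_ (hsubdrop i (by omega))
      rw [hw]
      exact (List.Sublist.refl _).append (List.singleton_sublist.2 (hwmem j hij hj))
  · intro i j hij hj hlt
    by_contra! hc
    have htj : t ≤ j + 1 := by
      by_contra! hc'
      have := hud i (j + 1) (by omega) hc'
      omega
    have hinc : ∀ k, j + 1 ≤ k → k < m₁ → u i < u k := by
      intro k hk hkm
      rcases hk.eq_or_lt with rfl | hl
      · exact hc
      · exact hc.trans (hui _ _ htj hl hkm)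
    obtain ⟨w, hw, -⟩ := hsubtake (j + 1) hj
    have hprefix : (rowWord v (j + 1)).Sublist (rowWord v m₂) := by
      rw [hw]; exact List.sublist_append_left _ _
    obtain ⟨d, r, hdr, hd, hr⟩ := hv.sublist hprefix
    -- A nonempty `r` ends in `v j`, so `u i` and the larger letters after it extend the increasing
    -- part.
    have hlast : ∀ a ∈ r, a ≤ v j := by
      intro a ha
      rcases List.eq_nil_or_concat r with rfl | ⟨r', c, rfl⟩
      · simp at ha
      · rw [List.concat_eq_append] at *
        have hcj : v j = c := by
          have := congrArg List.getLast? hdr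
          simpa [rowWord_succ] using this
        rw [hcj]
        rcases List.mem_append.1 ha with ha | ha
        · exact ((List.pairwise_append.1 hr).2.2 a ha c (by simp)).le
        · rw [List.mem_singleton.1 ha]
    -- If the second condition fails, `v 0, …, v j, u i, u (j + 1), …, u (m₁ - 1)` is a hook of
    -- length `m₁ + 1`.
    have := h (rowWord v (j + 1) ++ (u i :: rowWord (fun k => u (j + 1 + k)) (m₁ - (j + 1)))) ?_ ?_
    · simp [length_rowWord] at this
      omega
    · refine ⟨d, r ++ (u i :: rowWord (fun k => u (j + 1 + k)) (m₁ - (j + 1))), by simp [hdr], hd, ?_⟩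
      rw [List.pairwise_append, List.pairwise_cons]
      refine ⟨hr, ⟨?_, ?_⟩, ?_⟩
      · intro b hb
        obtain ⟨k, hk, rfl⟩ := mem_rowWord.1 hb
        exact hinc _ (by omega) (by omega)
      · exact pairwise_rowWord.2 fun a b hab hb => hui _ _ (by omega) (by omega) (by omega)
      · intro a ha b hb
        have ha' := hlast a ha
        rcases List.mem_cons.1 hb with rfl | hb
        · omega
        · obtain ⟨k, hk, rfl⟩ := mem_rowWord.1 hb
          have := hinc (j + 1 + k) (by omega) (by omega)
          omega
    · refine hprefix.append ?_
      have : rowWord u m₁ = rowWord u (j + 1) ++ rowWord (fun k => u (j + 1 + k)) (m₁ - (j + 1)) := by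
        rw [← rowWord_add, Nat.add_sub_cancel' (by omega)]
      rw [this]
      exact List.Sublist.append (l₁ := [u i])
        (List.singleton_sublist.2 (mem_rowWord.2 ⟨i, by omega, rfl⟩)) (List.Sublist.refl _)


/-! ## The `q(n)`-crystal of words -/

section Words

variable {n : ℕ}

theorem pairing_add (x y : Weight n) (i : ℕ) :
    Weight.pairing (x + y) i = Weight.pairing x i + Weight.pairing y i := by
  simp only [Weight.pairing, Weight.coeff]
  split_ifs <;> simp <;> ring

theorem coeff_eps {i : ℕ} (hi : 1 ≤ i ∧ i ≤ n) (k : ℕ) :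
    Weight.coeff (eps n k) i = if i = k then 1 else 0 := by
  simp [Weight.coeff, eps, hi]

theorem pairing_eps (i : GlIndex n) (k : ℕ) :
    Weight.pairing (eps n k) i.1 = (if k = i.1 then 1 else 0) - (if k = i.1 + 1 then 1 else 0) := by
  have := i.2
  rw [Weight.pairing, coeff_eps (by omega), coeff_eps (by omega)]
  simp only [eq_comm]

theorem wordEps_nonneg (i : ℕ) (w : List (Letter n)) : 0 ≤ wordEps i w := by
  cases w with
  | nil => exact le_rfl
  | cons a w =>
    refine le_max_of_le_left ?_
    unfold letterEps
    split_ifs <;> simp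

/-- Bracketing in recursive form: a letter `i` cancels one unmatched `i + 1` to its right, if there
is one, and a letter `i + 1` adds one. -/
theorem wordEps_cons (i : GlIndex n) (a : Letter n) (w : List (Letter n)) :
    wordEps i.1 (a :: w) = if a.1 = i.1 then max 0 (wordEps i.1 w - 1)
      else if a.1 = i.1 + 1 then wordEps i.1 w + 1 else wordEps i.1 w := by
  have h0 := wordEps_nonneg i.1 w
  rw [wordEps, letterEps, pairing_eps]
  split_ifs <;> omega

theorem wordPhi_eq (i : GlIndex n) (w : List (Letter n)) :
    wordPhi i.1 w = Weight.pairing (wordWt w) i.1 + wordEps i.1 w := by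
  induction w with
  | nil => simp [wordPhi, wordWt, wordEps, Weight.pairing, Weight.coeff]
  | cons a w ih =>
    rw [wordPhi, wordEps, wordWt, pairing_add, ih, pairing_eps, letterPhi, letterEps]
    split_ifs <;> omega

/-- The value of `ε_i` on the changed tail decides where `e_i` acts, so inversion and the change of
`ε_i` need a common induction. -/
theorem eps_of_wordF (i : GlIndex n) {w w' : List (Letter n)} (h : wordF i.1 w = some w') :
    wordE i.1 w' = some w ∧ wordEps i.1 w' = wordEps i.1 w + 1 ∧
      wordWt w' = wordWt w - simpleRoot n i.1 := by
  induction w generalizing w' with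
  | nil => simp [wordF] at h
  | cons a w ih =>
    have h0 := wordEps_nonneg i.1 w
    have hi := i.2
    rw [wordF] at h
    split_ifs at h with hc
    · obtain ⟨a', ha', rfl⟩ := Option.map_eq_some_iff.1 h
      rw [letterF] at ha'
      split_ifs at ha' with hl
      obtain rfl := Option.some.inj ha'
      simp only [letterPhi, hl.1, if_true] at hc
      refine ⟨?_, ?_, ?_⟩
      · rw [wordE, if_pos (by simp [letterPhi]; omega), letterE, dif_pos ⟨hi.1, rfl⟩]
        simp only [Option.map_some, Option.some.injEq, List.cons.injEq, and_true]
        exact Subtype.ext hl.1.symm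
      · rw [wordEps_cons, wordEps_cons, if_neg (by simp), if_pos rfl, if_pos hl.1]
        omega
      · simp only [wordWt, simpleRoot, hl.1]
        abel
    · obtain ⟨w₀, hw₀, rfl⟩ := Option.map_eq_some_iff.1 h
      obtain ⟨h1, h2, h3⟩ := ih hw₀
      refine ⟨?_, ?_, ?_⟩
      · rw [wordE, if_neg (by omega), h1]; rfl
      · rw [letterPhi] at hc
        rw [wordEps_cons, wordEps_cons]
        split_ifs at hc ⊢ <;> omega
      · simp only [wordWt, h3]
        abel

theorem wordF_of_wordE (i : GlIndex n) {w w' : List (Letter n)} (h : wordE i.1 w = some w') :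
    wordF i.1 w' = some w := by
  induction w generalizing w' with
  | nil => simp [wordE] at h
  | cons a w ih =>
    have h0 := wordEps_nonneg i.1 w
    have hi := i.2
    rw [wordE] at h
    split_ifs at h with hc
    · obtain ⟨a', ha', rfl⟩ := Option.map_eq_some_iff.1 h
      rw [letterE] at ha'
      split_ifs at ha' with hl
      obtain rfl := Option.some.inj ha'
      simp only [letterPhi, hl.2, Nat.succ_ne_self, if_false] at hc
      rw [wordF, if_pos (by simp [letterPhi]; omega), letterF, dif_pos ⟨rfl, hi.2⟩]
      simp only [Option.map_some, Option.some.injEq, List.cons.injEq, and_true]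
      exact Subtype.ext hl.2.symm
    · obtain ⟨w₀, hw₀, rfl⟩ := Option.map_eq_some_iff.1 h
      have h1 := ih hw₀
      have h2 := (eps_of_wordF i h1).2.1
      rw [wordF, if_neg (by omega), h1]
      rfl

theorem wordF_eq_some_iff (i : GlIndex n) {w w' : List (Letter n)} :
    wordF i.1 w = some w' ↔ wordE i.1 w' = some w :=
  ⟨fun h => (eps_of_wordF i h).1, wordF_of_wordE i⟩

/-- Neither `1` nor `2` occurs in `w`. -/
def AvoidsOneTwo (w : List (Letter n)) : Prop := ∀ a ∈ w, a.1 ≠ 1 ∧ a.1 ≠ 2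

theorem wordWt_nonneg (w : List (Letter n)) (k : Letter n) : 0 ≤ wordWt w k := by
  induction w with
  | nil => exact le_rfl
  | cons a w ih =>
    rw [wordWt, Pi.add_apply, eps]
    split_ifs <;> omega

theorem coeff_wordWt (w : List (Letter n)) (i : ℕ) :
    Weight.coeff (wordWt w) i = ((w.map Subtype.val).count i : ℤ) := by
  induction w with
  | nil => simp [Weight.coeff, wordWt]
  | cons a w ih =>
    have ha := a.2
    by_cases hi : 1 ≤ i ∧ i ≤ n
    · have : Weight.coeff (wordWt (a :: w)) i =
          Weight.coeff (eps n a.1) i + Weight.coeff (wordWt w) i := by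
        simp [Weight.coeff, wordWt, hi]
      rw [this, ih, coeff_eps hi, List.map_cons, List.count_cons]
      by_cases h : a.1 = i
      · simp [h, add_comm]
      · simp [h, Ne.symm h]
    · have hne : a.1 ≠ i := fun h => hi (h ▸ ha)
      rw [List.map_cons, List.count_cons_of_ne hne, ← ih]
      simp [Weight.coeff, hi]

theorem coeff_eq_zero_iff (w : List (Letter n)) :
    (Weight.coeff (wordWt w) 1 = 0 ∧ Weight.coeff (wordWt w) 2 = 0) ↔ AvoidsOneTwo w := by
  simp only [coeff_wordWt, Nat.cast_eq_zero, List.count_eq_zero, List.mem_map, AvoidsOneTwo]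
  constructor
  · intro h a ha
    exact ⟨fun h1 => h.1 ⟨a, ha, h1⟩, fun h1 => h.2 ⟨a, ha, h1⟩⟩
  · intro h
    exact ⟨fun ⟨a, ha, h1⟩ => (h a ha).1 h1, fun ⟨a, ha, h1⟩ => (h a ha).2 h1⟩

open Classical in
theorem wordEBar_cons (a : Letter n) (w : List (Letter n)) :
    wordEBar (a :: w) = if AvoidsOneTwo w then (letterE 1 a).map (fun a' => a' :: w)
      else (wordEBar w).map (fun w' => a :: w') := by
  rw [wordEBar]
  exact if_congr (coeff_eq_zero_iff w) rfl rfl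

open Classical in
theorem wordFBar_cons (a : Letter n) (w : List (Letter n)) :
    wordFBar (a :: w) = if AvoidsOneTwo w then (letterF 1 a).map (fun a' => a' :: w)
      else (wordFBar w).map (fun w' => a :: w') := by
  rw [wordFBar]
  exact if_congr (coeff_eq_zero_iff w) rfl rfl

theorem letterE_eq_some_iff {i : ℕ} (hi : 1 ≤ i) {a a' : Letter n} :
    letterE i a = some a' ↔ a.1 = i + 1 ∧ a'.1 = i := by
  unfold letterE
  split_ifs with h
  · simp only [Option.some.injEq]
    constructor
    · rintro rfl; exact ⟨h.2, rfl⟩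
    · rintro ⟨-, h'⟩; exact Subtype.ext h'.symm
  · simp only [false_iff]
    exact fun h' => h ⟨hi, h'.1⟩

theorem letterF_eq_some_iff {i : ℕ} {a a' : Letter n} :
    letterF i a = some a' ↔ a.1 = i ∧ a'.1 = i + 1 := by
  unfold letterF
  split_ifs with h
  · simp only [Option.some.injEq]
    constructor
    · rintro rfl; exact ⟨h.1, rfl⟩
    · rintro ⟨-, h'⟩; exact Subtype.ext h'.symm
  · simp only [false_iff]
    exact fun h' => h ⟨h'.1, by have := a'.2.2; omega⟩

/-- The recursion searches for the last letter in `{1, 2}`. `wordEBar_eq_some_iff` has the same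
right-hand side, which makes the barred operators mutually inverse. -/
theorem wordFBar_eq_some_iff {w w' : List (Letter n)} :
    wordFBar w = some w' ↔ ∃ A B x y, w = A ++ x :: B ∧ w' = A ++ y :: B ∧ x.1 = 1 ∧ y.1 = 2 ∧
      AvoidsOneTwo B := by
  induction w generalizing w' with
  | nil => simp [wordFBar]
  | cons a w ih =>
    rw [wordFBar_cons]
    split_ifs with hc
    · simp only [Option.map_eq_some_iff, letterF_eq_some_iff]
      constructor
      · rintro ⟨a', ⟨h1, h2⟩, rfl⟩
        exact ⟨[], w, a, a', rfl, rfl, h1, h2, hc⟩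
      · rintro ⟨A, B, x, y, h, rfl, hx, hy, hB⟩
        rcases List.cons_eq_append_iff.1 h with ⟨rfl, h⟩ | ⟨A, rfl, rfl⟩
        · obtain ⟨rfl, rfl⟩ := List.cons.inj h
          exact ⟨y, ⟨hx, hy⟩, rfl⟩
        · exact absurd hx (hc x (by simp)).1
    · simp only [Option.map_eq_some_iff, ih]
      constructor
      · rintro ⟨w₀, ⟨A, B, x, y, rfl, rfl, h⟩, rfl⟩
        exact ⟨a :: A, B, x, y, rfl, rfl, h⟩
      · rintro ⟨A, B, x, y, h, rfl, hx, hy, hB⟩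
        rcases List.cons_eq_append_iff.1 h with ⟨rfl, h⟩ | ⟨A, rfl, rfl⟩
        · obtain ⟨rfl, rfl⟩ := List.cons.inj h
          exact absurd hB hc
        · exact ⟨_, ⟨A, B, x, y, rfl, rfl, hx, hy, hB⟩, rfl⟩

theorem wordEBar_eq_some_iff {w w' : List (Letter n)} :
    wordEBar w' = some w ↔ ∃ A B x y, w = A ++ x :: B ∧ w' = A ++ y :: B ∧ x.1 = 1 ∧ y.1 = 2 ∧
      AvoidsOneTwo B := by
  induction w' generalizing w with
  | nil => simp [wordEBar]
  | cons a w' ih =>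
    rw [wordEBar_cons]
    split_ifs with hc
    · simp only [Option.map_eq_some_iff, letterE_eq_some_iff le_rfl]
      constructor
      · rintro ⟨a', ⟨h1, h2⟩, rfl⟩
        exact ⟨[], w', a', a, rfl, rfl, h2, h1, hc⟩
      · rintro ⟨A, B, x, y, rfl, h, hx, hy, hB⟩
        rcases List.cons_eq_append_iff.1 h with ⟨rfl, h⟩ | ⟨A, rfl, rfl⟩
        · obtain ⟨rfl, rfl⟩ := List.cons.inj h
          exact ⟨x, ⟨hy, hx⟩, rfl⟩
        · exact absurd hy (hc y (by simp)).2
    · simp only [Option.map_eq_some_iff, ih]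
      constructor
      · rintro ⟨w₀, ⟨A, B, x, y, rfl, rfl, h⟩, rfl⟩
        exact ⟨a :: A, B, x, y, rfl, rfl, h⟩
      · rintro ⟨A, B, x, y, rfl, h, hx, hy, hB⟩
        rcases List.cons_eq_append_iff.1 h with ⟨rfl, h⟩ | ⟨A, rfl, rfl⟩
        · obtain ⟨rfl, rfl⟩ := List.cons.inj h
          exact absurd hB hc
        · exact ⟨_, ⟨A, B, x, y, rfl, rfl, hx, hy, hB⟩, rfl⟩

theorem wordWt_append (A B : List (Letter n)) : wordWt (A ++ B) = wordWt A + wordWt B := by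
  induction A with
  | nil => simp [wordWt]
  | cons a A ih => rw [List.cons_append, wordWt, ih, wordWt, add_assoc]

theorem wordWt_of_wordFBar {w w' : List (Letter n)} (h : wordFBar w = some w') :
    wordWt w' = wordWt w - simpleRoot n 1 := by
  obtain ⟨A, B, x, y, rfl, rfl, hx, hy, -⟩ := wordFBar_eq_some_iff.1 h
  simp only [wordWt_append, wordWt, hx, hy, simpleRoot]
  abel

theorem wordFBar_iff_wordEBar {w w' : List (Letter n)} :
    wordFBar w = some w' ↔ wordEBar w' = some w :=
  wordFBar_eq_some_iff.trans wordEBar_eq_some_iff.symm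

/-- The letters `1`, `2` do not interact with `e_i`, `f_i`, `ε_i` for `i ≥ 3`. -/
theorem wordEps_of_wordFBar (i : GlIndex n) (hi : 3 ≤ i.1) {w w' : List (Letter n)}
    (h : wordFBar w = some w') : wordEps i.1 w' = wordEps i.1 w := by
  obtain ⟨A, B, x, y, rfl, rfl, hx, hy, -⟩ := wordFBar_eq_some_iff.1 h
  clear h
  induction A with
  | nil =>
    rw [List.nil_append, List.nil_append, wordEps_cons, wordEps_cons, hx, hy]
    rw [if_neg (by omega), if_neg (by omega), if_neg (by omega), if_neg (by omega)]
  | cons a A ih => rw [List.cons_append, List.cons_append, wordEps_cons, wordEps_cons, ih]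

theorem avoidsOneTwo_of_wordF (i : GlIndex n) (hi : 3 ≤ i.1) {w w' : List (Letter n)}
    (h : wordF i.1 w = some w') : AvoidsOneTwo w' ↔ AvoidsOneTwo w := by
  have h3 := (eps_of_wordF i h).2.2
  have hk : ∀ k, k < 3 → Weight.coeff (wordWt w') k = Weight.coeff (wordWt w) k := by
    intro k hk
    have h1 : k ≠ i.1 := by omega
    have h2 : k ≠ i.1 + 1 := by omega
    rw [h3]
    simp [Weight.coeff, simpleRoot, eps, h1, h2]
  rw [← coeff_eq_zero_iff, ← coeff_eq_zero_iff, hk 1 (by omega), hk 2 (by omega)]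

theorem letterPhi_of_ne {i : ℕ} {a : Letter n} (h : a.1 ≠ i) : letterPhi i a = 0 := if_neg h

theorem wordF_cons_of_lt (i : GlIndex n) {a : Letter n} (ha : a.1 < i.1) (w : List (Letter n)) :
    wordF i.1 (a :: w) = (wordF i.1 w).map (fun w' => a :: w') := by
  have h0 := wordEps_nonneg i.1 w
  rw [wordF, letterPhi_of_ne ha.ne, if_neg (by omega)]

/-- If the barred operator acts on the first letter, that letter is `1` or `2` and `f_i` skips it
before and after. If it acts on the tail, `ε_i` of the tail is unchanged, so `f_i` chooses the same
tensor factor. -/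
theorem wordF_bind_wordFBar (i : GlIndex n) (hi : 3 ≤ i.1) {w w' : List (Letter n)}
    (h : wordFBar w = some w') : (wordF i.1 w).bind wordFBar = wordF i.1 w' := by
  induction w generalizing w' with
  | nil => simp [wordFBar] at h
  | cons a w ih =>
    have h' := h
    rw [wordFBar_cons] at h
    split_ifs at h with hc
    · obtain ⟨a', ha', rfl⟩ := Option.map_eq_some_iff.1 h
      rw [letterF_eq_some_iff] at ha'
      rw [wordF_cons_of_lt i (by omega), wordF_cons_of_lt i (by omega)]
      rcases hw : wordF i.1 w with _ | w₁
      · rfl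
      · simp only [Option.map_some, Option.bind_some]
        rw [wordFBar_cons, if_pos ((avoidsOneTwo_of_wordF i hi hw).2 hc),
          letterF_eq_some_iff.2 ha']
        rfl
    · obtain ⟨w₀, hw₀, rfl⟩ := Option.map_eq_some_iff.1 h
      rw [wordF, wordF, wordEps_of_wordFBar i hi hw₀]
      split_ifs with hp
      · rcases hl : letterF i.1 a with _ | a'
        · rfl
        · simp only [Option.map_some, Option.bind_some]
          rw [wordFBar_cons, if_neg hc, hw₀]
          rfl
      · rw [← ih hw₀]
        rcases hw : wordF i.1 w with _ | w₁
        · rfl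
        · simp only [Option.map_some, Option.bind_some]
          rw [wordFBar_cons, if_neg (fun h1 => hc ((avoidsOneTwo_of_wordF i hi hw).1 h1))]

theorem wordFBar_isSome_of_wordF (i : GlIndex n) (hi : 3 ≤ i.1) {w w' : List (Letter n)}
    (h : wordF i.1 w = some w') : (wordFBar w').isSome = (wordFBar w).isSome := by
  induction w generalizing w' with
  | nil => simp [wordF] at h
  | cons a w ih =>
    rw [wordF] at h
    split_ifs at h with hp
    · obtain ⟨a', ha', rfl⟩ := Option.map_eq_some_iff.1 h
      rw [letterF_eq_some_iff] at ha'
      have h1 : letterF 1 a = none := by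
        rw [Option.eq_none_iff_forall_ne_some]
        intro b hb
        have := letterF_eq_some_iff.1 hb
        omega
      have h2 : letterF 1 a' = none := by
        rw [Option.eq_none_iff_forall_ne_some]
        intro b hb
        have := letterF_eq_some_iff.1 hb
        omega
      rw [wordFBar_cons, wordFBar_cons, h1, h2]
      split_ifs <;> simp
    · obtain ⟨w₀, hw₀, rfl⟩ := Option.map_eq_some_iff.1 h
      rw [wordFBar_cons, wordFBar_cons]
      by_cases hc : AvoidsOneTwo w
      · rw [if_pos hc, if_pos ((avoidsOneTwo_of_wordF i hi hw₀).2 hc)]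
        simp
      · rw [if_neg hc, if_neg (fun h1 => hc ((avoidsOneTwo_of_wordF i hi hw₀).1 h1))]
        simpa using ih hw₀

theorem wordEBar_isSome_of_wordF (i : GlIndex n) (hi : 3 ≤ i.1) {w w' : List (Letter n)}
    (h : wordF i.1 w = some w') : (wordEBar w').isSome = (wordEBar w).isSome := by
  induction w generalizing w' with
  | nil => simp [wordF] at h
  | cons a w ih =>
    rw [wordF] at h
    split_ifs at h with hp
    · obtain ⟨a', ha', rfl⟩ := Option.map_eq_some_iff.1 h
      rw [letterF_eq_some_iff] at ha'
      have h1 : letterE 1 a = none := by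
        rw [Option.eq_none_iff_forall_ne_some]
        intro b hb
        have := (letterE_eq_some_iff le_rfl).1 hb
        omega
      have h2 : letterE 1 a' = none := by
        rw [Option.eq_none_iff_forall_ne_some]
        intro b hb
        have := (letterE_eq_some_iff le_rfl).1 hb
        omega
      rw [wordEBar_cons, wordEBar_cons, h1, h2]
      split_ifs <;> simp
    · obtain ⟨w₀, hw₀, rfl⟩ := Option.map_eq_some_iff.1 h
      rw [wordEBar_cons, wordEBar_cons]
      by_cases hc : AvoidsOneTwo w
      · rw [if_pos hc, if_pos ((avoidsOneTwo_of_wordF i hi hw₀).2 hc)]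
        simp
      · rw [if_neg hc, if_neg (fun h1 => hc ((avoidsOneTwo_of_wordF i hi hw₀).1 h1))]
        simpa using ih hw₀

end Words

/-- If `f`, `e` and `g`, `h` are pairs of mutually inverse partial bijections, `f` and `g` commute
where `f` is defined, and the domains of `f` and `e` are stable under `g`, then all commute. -/
theorem bind_comm_of_iff {W : Type*} {f e g h : W → Option W}
    (hfe : ∀ w w', f w = some w' ↔ e w' = some w) (hgh : ∀ w w', g w = some w' ↔ h w' = some w)
    (hcomm : ∀ w w', f w = some w' → (g w).bind f = g w')
    (hf : ∀ w w', g w = some w' → (f w').isSome = (f w).isSome)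
    (he : ∀ w w', g w = some w' → (e w').isSome = (e w).isSome) :
    (∀ w, (g w).bind f = (f w).bind g) ∧ (∀ w, (h w).bind f = (f w).bind h) ∧
      (∀ w, (g w).bind e = (e w).bind g) ∧ (∀ w, (h w).bind e = (e w).bind h) := by
  have finj : ∀ {a b c}, f a = some c → f b = some c → a = b := fun {a b c} h1 h2 => by
    rw [hfe] at h1 h2
    exact Option.some.inj (h1.symm.trans h2)
  have hfs : ∀ {w w' v}, g w = some w' → f w = some v → ∃ v', f w' = some v' :=
    fun {w w' v} h1 h2 => Option.isSome_iff_exists.1 (by rw [hf _ _ h1, h2]; rfl)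
  have hes : ∀ {w w' v}, g w = some w' → e w' = some v → ∃ v', e w = some v' :=
    fun {w w' v} h1 h2 => Option.isSome_iff_exists.1 (by rw [← he _ _ h1, h2]; rfl)
  have hfs' : ∀ {w w' v}, g w = some w' → f w' = some v → ∃ v', f w = some v' :=
    fun {w w' v} h1 h2 => Option.isSome_iff_exists.1 (by rw [← hf _ _ h1, h2]; rfl)
  -- Completing commutative squares with sides `f` and `g`; below, identities involving `e` or `h`
  -- are rewritten as such squares, and injectivity of `f` identifies corners.
  have square : ∀ {w w' v}, f w = some w' → g w' = some v → ∃ u, g w = some u ∧ f u = some v :=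
    fun {w w' v} h1 h2 => Option.bind_eq_some_iff.1 ((hcomm _ _ h1).trans h2)
  have square' : ∀ {w w' u v}, f w = some w' → g w = some u → f u = some v → g w' = some v :=
    fun {w w' u v} h1 h2 h3 => by rw [← hcomm _ _ h1, h2]; exact h3
  refine ⟨fun w => ?_, fun w => ?_, fun w => ?_, fun w => ?_⟩
  · rcases hw : f w with _ | w'
    · rcases hg : g w with _ | v
      · rfl
      · have := hf _ _ hg
        rw [hw] at this
        simpa using this
    · rw [hcomm _ _ hw]; rfl
  all_goals
    refine Option.ext fun z => ?_
    simp only [Option.bind_eq_some_iff, ← hgh, ← hfe]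
    constructor
  · rintro ⟨v, hv, hz⟩
    obtain ⟨u, hu⟩ := hfs hv hz
    exact ⟨u, hu, square' hz hv hu⟩
  · rintro ⟨u, hu, hz⟩
    obtain ⟨v, hv⟩ := hes hz ((hfe _ _).1 hu)
    rw [← hfe] at hv
    obtain ⟨w', h1, h2⟩ := square hv hz
    exact ⟨v, by rw [h1, finj h2 hu], hv⟩
  · rintro ⟨v, hv, hz⟩
    obtain ⟨u, hu⟩ := hes hv ((hfe _ _).1 hz)
    rw [← hfe] at hu
    obtain ⟨z', h1, h2⟩ := square hu hv
    exact ⟨u, hu, by rw [h1, finj h2 hz]⟩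
  · rintro ⟨u, hu, hz⟩
    obtain ⟨v, hv⟩ := hfs hz hu
    exact ⟨v, square' hu hz hv, hv⟩
  · rintro ⟨v, hv, hz⟩
    obtain ⟨u, h1, h2⟩ := square hz hv
    exact ⟨u, h2, h1⟩
  · rintro ⟨u, hu, hz⟩
    obtain ⟨v, hv⟩ := hfs' hz hu
    exact ⟨v, square' hv hz hu, hv⟩

theorem wordCrystal_isQCrystal (n : ℕ) : (wordCrystal n).IsQCrystal := by
  have hcomm : ∀ i : GlIndex n, 3 ≤ i.1 → _ := fun i hi =>
    bind_comm_of_iff (f := wordFBar) (e := wordEBar) (g := wordF i.1) (h := wordE i.1)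
      (fun w w' => wordFBar_iff_wordEBar) (fun w w' => wordF_eq_some_iff i)
      (fun w w' => wordF_bind_wordFBar i hi) (fun w w' => wordFBar_isSome_of_wordF i hi)
      (fun w w' => wordEBar_isSome_of_wordF i hi)
  have hphi : ∀ (i : GlIndex n) (b : List (Letter n)), (wordCrystal n).φ i b =
      ((Weight.pairing (wordWt b) i.1 + wordEps i.1 b : ℤ) : WithBot ℤ) := fun i b =>
    congrArg _ (wordPhi_eq i b)
  have hpair : ∀ i : GlIndex n, Weight.pairing (simpleRoot n i.1) i.1 = 2 := by
    intro i
    have h := pairing_add (simpleRoot n i.1) (eps n (i.1 + 1)) i.1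
    rw [simpleRoot, sub_add_cancel, pairing_eps, pairing_eps] at h
    simp at h
    rw [simpleRoot]
    omega
  have hf : ∀ (i : GlIndex n) (b b' : List (Letter n)), wordF i.1 b = some b' →
      wordEps i.1 b' = wordEps i.1 b + 1 ∧ wordPhi i.1 b' = wordPhi i.1 b - 1 ∧
        wordWt b' = wordWt b - simpleRoot n i.1 := by
    intro i b b' h
    obtain ⟨-, h1, h2⟩ := eps_of_wordF i h
    refine ⟨h1, ?_, h2⟩
    have h3 := pairing_add (wordWt b') (simpleRoot n i.1) i.1
    rw [h2, sub_add_cancel, ← h2, hpair] at h3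
    rw [wordPhi_eq, wordPhi_eq, h1]
    omega
  refine
    { phi_eq := fun i b => (hphi i b).trans (by rw [WithBot.coe_add]; rfl)
      e_spec := fun i b b' h => ?_
      f_spec := fun i b b' h => ?_
      f_iff_e := fun i b b' => wordF_eq_some_iff i
      eq_none_of_bot := fun i b h => absurd h (WithBot.coe_ne_bot)
      wt_nonneg := wordWt_nonneg
      wt_e_bar := fun b b' h => ?_
      wt_f_bar := fun b b' h => wordWt_of_wordFBar h
      f_bar_iff_e_bar := fun b b' => wordFBar_iff_wordEBar
      e_bar_comm_e := fun i hi => (hcomm i hi).2.2.2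
      e_bar_comm_f := fun i hi => (hcomm i hi).2.2.1
      f_bar_comm_e := fun i hi => (hcomm i hi).2.1
      f_bar_comm_f := fun i hi => (hcomm i hi).1
      e_bar_string := fun i hi b b' h => ?_ }
  · obtain ⟨h1, h2, h3⟩ := hf i b' b ((wordF_eq_some_iff i).2 h)
    refine ⟨?_, ?_, ?_⟩
    · change ((_ : ℤ) : WithBot ℤ) = ((_ : ℤ) : WithBot ℤ) + _
      rw [← WithBot.coe_add, WithBot.coe_inj]
      omega
    · change ((_ : ℤ) : WithBot ℤ) = ((_ : ℤ) : WithBot ℤ) + _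
      rw [← WithBot.coe_add, WithBot.coe_inj]
      omega
    · exact (sub_eq_iff_eq_add.1 h3.symm)
  · obtain ⟨h1, h2, h3⟩ := hf i b b' h
    refine ⟨?_, ?_, h3⟩
    · change ((_ : ℤ) : WithBot ℤ) = ((_ : ℤ) : WithBot ℤ) + _
      rw [← WithBot.coe_add, WithBot.coe_inj]
      omega
    · change ((_ : ℤ) : WithBot ℤ) = ((_ : ℤ) : WithBot ℤ) + _
      rw [← WithBot.coe_add, WithBot.coe_inj]
      omega
  · have := wordWt_of_wordFBar (wordFBar_iff_wordEBar.2 h)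
    exact sub_eq_iff_eq_add.1 this.symm
  · have h' := wordFBar_iff_wordEBar.2 h
    have h1 := wordEps_of_wordFBar i hi h'
    have h2 : Weight.pairing (wordWt b') i.1 = Weight.pairing (wordWt b) i.1 := by
      rw [wordWt_of_wordFBar h']
      have hi1 : i.1 ≠ 1 := by omega
      have hi2 : i.1 ≠ 2 := by omega
      have hi3 : i.1 ≠ 0 := by omega
      simp [Weight.pairing, Weight.coeff, simpleRoot, eps, hi1, hi2, hi3]
    exact ⟨congrArg (fun z : ℤ => (z : WithBot ℤ)) h1.symm, by rw [hphi, hphi, h1, h2]⟩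

/-- The data induced on `B` through an injective map to a crystal. -/
noncomputable def CrystalData.induced {n : ℕ} {B W : Type*} (C : CrystalData n W) (g : B → W) :
    CrystalData n B where
  wt b := C.wt (g b)
  ε i b := C.ε i (g b)
  φ i b := C.φ i (g b)
  e i b := (C.e i (g b)).bind (Function.partialInv g)
  f i b := (C.f i (g b)).bind (Function.partialInv g)

theorem map_bind_partialInv {B W : Type*} {g : B → W} (hg : Function.Injective g) {o : Option W}
    (ho : ∀ w, o = some w → w ∈ Set.range g) : (o.bind (Function.partialInv g)).map g = o := by
  rcases o with _ | w
  · rfl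
  · obtain ⟨b, rfl⟩ := ho w rfl
    simp [Function.partialInv_left hg]

/-- Because the range is stable, the partial inverse loses no nonzero value, and `g` intertwines the
operators on both sides. Each axiom is then pulled back along the injective map `Option.map g`. -/
theorem CrystalData.IsQCrystal.induced {n : ℕ} {B W : Type*} {C : CrystalData n W}
    (hC : C.IsQCrystal) {g : B → W} (hg : Function.Injective g)
    (he : ∀ i b w, C.e i (g b) = some w → w ∈ Set.range g)
    (hf : ∀ i b w, C.f i (g b) = some w → w ∈ Set.range g) : (C.induced g).IsQCrystal := by
  have hem : ∀ i b, ((C.induced g).e i b).map g = C.e i (g b) := fun i b =>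
    map_bind_partialInv hg (he i b)
  have hfm : ∀ i b, ((C.induced g).f i b).map g = C.f i (g b) := fun i b =>
    map_bind_partialInv hg (hf i b)
  have hiff : ∀ {o : Option B} {b : B}, o = some b ↔ o.map g = some (g b) := by
    intro o b
    rw [← Option.map_some, (Option.map_injective hg).eq_iff]
  have hnone : ∀ {o : Option B}, o = none ↔ o.map g = none := by
    intro o; simp
  have hbind : ∀ {u v : B → Option B} {u' v' : W → Option W},
      (∀ b, (u b).map g = u' (g b)) → (∀ b, (v b).map g = v' (g b)) →
      ∀ b, ((u b).bind v).map g = (u' (g b)).bind v' := by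
    intro u v u' v' hu hv b
    rw [← hu]
    rcases u b with _ | b'
    · rfl
    · exact hv b'
  have hcomm : ∀ {u v : B → Option B} {u' v' : W → Option W},
      (∀ b, (u b).map g = u' (g b)) → (∀ b, (v b).map g = v' (g b)) →
      (∀ w, (u' w).bind v' = (v' w).bind u') → ∀ b, (u b).bind v = (v b).bind u := by
    intro u v u' v' hu hv h b
    apply Option.map_injective hg
    rw [hbind hu hv, hbind hv hu, h]
  exact
    { phi_eq := fun i b => hC.phi_eq i (g b)
      e_spec := fun i b b' h => hC.e_spec i _ _ ((hem _ _).symm.trans (hiff.1 h))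
      f_spec := fun i b b' h => hC.f_spec i _ _ ((hfm _ _).symm.trans (hiff.1 h))
      f_iff_e := fun i b b' => by rw [hiff, hfm, hiff, hem]; exact hC.f_iff_e i _ _
      eq_none_of_bot := fun i b h => by
        rw [hnone, hem, hnone, hfm]; exact hC.eq_none_of_bot i _ h
      wt_nonneg := fun b => hC.wt_nonneg (g b)
      wt_e_bar := fun b b' h => hC.wt_e_bar _ _ ((hem _ _).symm.trans (hiff.1 h))
      wt_f_bar := fun b b' h => hC.wt_f_bar _ _ ((hfm _ _).symm.trans (hiff.1 h))
      f_bar_iff_e_bar := fun b b' => by rw [hiff, hfm, hiff, hem]; exact hC.f_bar_iff_e_bar _ _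
      e_bar_comm_e := fun i hi => hcomm (hem _) (hem _) (hC.e_bar_comm_e i hi)
      e_bar_comm_f := fun i hi => hcomm (hfm _) (hem _) (hC.e_bar_comm_f i hi)
      f_bar_comm_e := fun i hi => hcomm (hem _) (hfm _) (hC.f_bar_comm_e i hi)
      f_bar_comm_f := fun i hi => hcomm (hfm _) (hfm _) (hC.f_bar_comm_f i hi)
      e_bar_string := fun i hi b b' h =>
        hC.e_bar_string i hi _ _ ((hem _ _).symm.trans (hiff.1 h)) }

/-! ## The operators on words as moves -/

section Moves

variable {n : ℕ}

/-- With `exists_prefix_wordEps_le`, this identifies `ε_i` as the maximal excess of `i + 1` over `i`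
among all prefixes. -/
theorem count_sub_count_le_wordEps (i : GlIndex n) (w : List (Letter n)) {S : List ℕ}
    (hS : S <+: w.map Subtype.val) : (S.count (i.1 + 1) : ℤ) - S.count i.1 ≤ wordEps i.1 w := by
  induction w generalizing S with
  | nil => simp at hS; simp [hS, wordEps]
  | cons a w ih =>
    have h0 := wordEps_nonneg i.1 (a :: w)
    rcases S with _ | ⟨b, S⟩
    · simpa using h0
    · rw [List.map_cons, List.cons_prefix_cons] at hS
      obtain ⟨rfl, hS⟩ := hS
      have := ih hS
      rw [wordEps_cons] at h0 ⊢
      simp only [List.count_cons, beq_iff_eq]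
      split_ifs at h0 ⊢ <;> push_cast <;> omega

theorem exists_prefix_wordEps_le (i : GlIndex n) (w : List (Letter n)) :
    ∃ S, S <+: w.map Subtype.val ∧ wordEps i.1 w ≤ (S.count (i.1 + 1) : ℤ) - S.count i.1 := by
  induction w with
  | nil => exact ⟨[], by simp, by simp [wordEps]⟩
  | cons a w ih =>
    obtain ⟨S, hS, hle⟩ := ih
    by_cases h : wordEps i.1 (a :: w) ≤ 0
    · exact ⟨[], by simp, by simpa using h⟩
    · refine ⟨a.1 :: S, by simpa using hS, ?_⟩
      rw [wordEps_cons] at h ⊢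
      simp only [List.count_cons, beq_iff_eq]
      split_ifs at h ⊢ <;> push_cast <;> omega

theorem exists_balanced_of_wordF (i : GlIndex n) {w w' : List (Letter n)}
    (h : wordF i.1 w = some w') : ∃ A B x y, w = A ++ x :: B ∧ w' = A ++ y :: B ∧ x.1 = i.1 ∧
      y.1 = i.1 + 1 ∧ Balanced i.1 (A.map Subtype.val) (B.map Subtype.val) := by
  induction w generalizing w' with
  | nil => simp [wordF] at h
  | cons a w ih =>
    rw [wordF] at h
    split_ifs at h with hc
    · obtain ⟨a', ha', rfl⟩ := Option.map_eq_some_iff.1 h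
      rw [letterF_eq_some_iff] at ha'
      refine ⟨[], w, a, a', rfl, rfl, ha'.1, ha'.2, ?_, fun S hS => ?_⟩
      · intro S hS
        simp at hS
        simp [hS]
      · have := count_sub_count_le_wordEps i w hS
        rw [letterPhi, if_pos ha'.1] at hc
        omega
    · obtain ⟨w₀, hw₀, rfl⟩ := Option.map_eq_some_iff.1 h
      obtain ⟨A, B, x, y, rfl, rfl, hx, hy, hb⟩ := ih hw₀
      refine ⟨a :: A, B, x, y, rfl, rfl, hx, hy, fun S hS => ?_, hb.2⟩
      rw [List.map_cons, List.suffix_cons_iff] at hS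
      rcases hS with rfl | hS
      · have hA := hb.1 _ List.suffix_rfl
        by_cases ha : a.1 = i.1
        -- Here `f_i` skipped a letter `i`, so some prefix `S` of the tail has positive excess of `i
        -- + 1`. If `S` ends within `A`, the rest of `A` has nonnegative excess; if it goes past
        -- `x`, then `x` and the part in `B` only lower the excess. Either way `A` has excess at
        -- least `1`, which pays for the skipped letter.
        · obtain ⟨S, hS, hle⟩ := exists_prefix_wordEps_le i (A ++ x :: B)
          rw [letterPhi, if_pos ha] at hc
          rw [List.map_append, List.map_cons] at hS
          obtain ⟨T, hT⟩ := hS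
          generalize A.map Subtype.val = L at *
          generalize B.map Subtype.val = M at *
          have : (1 : ℤ) ≤ L.count (i.1 + 1) - L.count i.1 := by
            rcases List.append_eq_append_iff.1 hT with ⟨U, hU, -⟩ | ⟨S, rfl, hS⟩
            · have := hb.1 U ⟨S, hU.symm⟩
              rw [hU]
              simp only [List.count_append]
              push_cast
              omega
            · rcases S with _ | ⟨c, S⟩
              · simp at hle; omega
              · obtain ⟨hc', hS⟩ := List.cons.inj hS
                have h2 := hb.2 S ⟨T, hS.symm⟩
                rw [← hc', hx] at hle
                simp [List.count_append] at hle
                omega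
          simp only [List.count_cons, ha, beq_self_eq_true, if_true]
          simp
          omega
        · rw [List.count_cons_of_ne ha]
          exact hA.trans (List.count_le_count_cons)
      · exact hb.1 S hS

/-- The crystal operators replace one letter, by a move. -/
theorem exists_move_of_f (i : QIndex n) {w w' : List (Letter n)}
    (h : (wordCrystal n).f i w = some w') : ∃ A B x y, w = A ++ x :: B ∧ w' = A ++ y :: B ∧
      Move (A.map Subtype.val) (B.map Subtype.val) x.1 y.1 := by
  rcases i with i | _
  · obtain ⟨A, B, x, y, h1, h2, hx, hy, hb⟩ := exists_balanced_of_wordF i h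
    exact ⟨A, B, x, y, h1, h2, .inl ⟨i.1, .inl ⟨hx, hy⟩, hb⟩⟩
  · obtain ⟨A, B, x, y, h1, h2, hx, hy, hb⟩ := wordFBar_eq_some_iff.1 h
    refine ⟨A, B, x, y, h1, h2, .inr ⟨.inl ⟨hx, hy⟩, ?_, ?_⟩⟩ <;> rw [List.mem_map] <;>
      rintro ⟨a, ha, hv⟩
    · exact (hb a ha).1 hv
    · exact (hb a ha).2 hv

theorem exists_move_of_e (i : QIndex n) {w w' : List (Letter n)}
    (h : (wordCrystal n).e i w = some w') : ∃ A B x y, w = A ++ x :: B ∧ w' = A ++ y :: B ∧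
      Move (A.map Subtype.val) (B.map Subtype.val) x.1 y.1 := by
  have : (wordCrystal n).f i w' = some w := by
    rcases i with i | _
    · exact ((wordCrystal_isQCrystal n).f_iff_e i _ _).2 h
    · exact ((wordCrystal_isQCrystal n).f_bar_iff_e_bar _ _).2 h
  obtain ⟨A, B, x, y, h1, h2, hm⟩ := exists_move_of_f i this
  exact ⟨A, B, y, x, h2, h1, hm.symm⟩

end Moves


/-! ## Strict partitions -/

theorem StrictPartition.part_antitone (lam : StrictPartition) : Antitone lam.part :=
  antitone_nat_of_succ_le lam.part_succ_le

theorem StrictPartition.part_succ_lt (lam : StrictPartition) {k : ℕ} (h : lam.part (k + 1) ≠ 0) :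
    lam.part (k + 1) < lam.part k := by
  refine lt_of_le_of_ne (lam.part_succ_le k) fun he => h ?_
  rw [he]
  exact lam.eq_zero_of_eq k he.symm

theorem StrictPartition.part_ne_zero_iff (lam : StrictPartition) {k : ℕ} :
    lam.part k ≠ 0 ↔ k < lam.length := by
  classical
  have hex : ∃ p, lam.part p = 0 := by
    by_contra! h
    exact Set.infinite_univ (lam.finite_support.subset fun p _ => h p)
  have hsupp : Function.support lam.part = ↑(Finset.range (Nat.find hex)) := by
    ext p
    rw [Function.mem_support, Finset.coe_range, Set.mem_Iio, Nat.lt_find_iff]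
    refine ⟨fun h m hm h0 => h ?_, fun h => h p le_rfl⟩
    have := lam.part_antitone hm
    omega
  rw [length, hsupp, Set.ncard_coe_finset, Finset.card_range, ← Function.mem_support, hsupp]
  simp

theorem StrictPartition.part_le_of_subset {lam mu : StrictPartition}
    (h : mu.shiftedDiagram ⊆ lam.shiftedDiagram) (p : ℕ) : mu.part p ≤ lam.part p := by
  by_contra! hlt
  have : (p, p + lam.part p) ∈ mu.shiftedDiagram := ⟨by simp, by simpa using hlt⟩
  simpa using (h this).2

/-! ## Filling the removed diagram with large letters -/

section Padding

variable {n : ℕ} {lam mu : StrictPartition} (T : SkewTableau lam mu (Letter n))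

/-- The tableau of straight shape `lam` obtained by filling row `p` of the diagram of `mu` with
`n + mu.part p`. -/
def padded (p q : ℕ) : ℕ :=
  if h : mu.part p ≤ q ∧ q < lam.part p then (T ⟨(p, p + q), box_mem h⟩).1 else n + mu.part p

variable {T}

theorem padded_of_lt {p q : ℕ} (h : q < mu.part p) : padded T p q = n + mu.part p :=
  dif_neg (by omega)

theorem mem_entry_iff {p q : ℕ} {a : Letter n} :
    a ∈ SkewTableau.entry T p q ↔ (mu.part p ≤ q ∧ q < lam.part p) ∧ padded T p q = a.1 := by
  unfold SkewTableau.entry padded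
  split_ifs with h
  · simp only [Option.mem_def, Option.some.injEq, h, and_self, true_and]
    exact Subtype.ext_iff
  · simp [h]

theorem exists_mem_entry {p q : ℕ} (h : mu.part p ≤ q ∧ q < lam.part p) :
    ∃ a ∈ SkewTableau.entry T p q, padded T p q = a.1 := by
  refine ⟨T ⟨(p, p + q), box_mem h⟩, ?_, ?_⟩
  · rw [SkewTableau.entry, dif_pos h]; rfl
  · rw [padded, dif_pos h]

theorem padded_pos {p q : ℕ} (h : q < lam.part p) : 1 ≤ padded T p q := by
  unfold padded
  split_ifs with h'
  · exact (T _).2.1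
  · omega

theorem padded_le_iff {p q : ℕ} (h : q < lam.part p) : padded T p q ≤ n ↔ mu.part p ≤ q := by
  unfold padded
  split_ifs with h'
  · exact ⟨fun _ => h'.1, fun _ => (T _).2.2⟩
  · omega

theorem filter_rowWord_padded (p : ℕ) :
    (rowWord (padded T p) (lam.part p)).filter (· ≤ n) =
      (SkewTableau.row T p).map Subtype.val := by
  have key : ∀ l : List ℕ, (∀ q ∈ l, q < lam.part p) → (l.map (padded T p)).filter (· ≤ n) =
      (l.filterMap (SkewTableau.entry T p)).map Subtype.val := by
    intro l hl
    induction l with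
    | nil => rfl
    | cons q l ih =>
      have hq := hl q (by simp)
      have ih := ih fun q hq => hl q (List.mem_cons_of_mem _ hq)
      by_cases hmu : mu.part p ≤ q
      · obtain ⟨a, ha, hpa⟩ := exists_mem_entry (T := T) ⟨hmu, hq⟩
        rw [List.filterMap_cons_some ha, List.map_cons, List.map_cons, List.filter_cons_of_pos, ih,
          hpa]
        simpa [padded_le_iff hq] using hmu
      · have hnone : SkewTableau.entry T p q = none := dif_neg (by omega)
        rw [List.filterMap_cons_none hnone, List.map_cons, List.filter_cons_of_neg, ih]
        simpa [padded_le_iff hq] using hmu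
  exact key _ fun q hq => List.mem_range.1 hq

/-- `IsHook` allows either part to be empty and marks no turning letter. When both parts are
nonempty, that letter is the smaller of the last decreasing and the first increasing one. -/
theorem isHookWord_iff {u : List (Letter n)} (hu : u ≠ []) :
    IsHookWord u ↔ IsHook (u.map Subtype.val) := by
  constructor
  · rintro ⟨d, x, r, rfl, hd, hr⟩
    refine ⟨(d ++ [x]).map Subtype.val, r.map Subtype.val, by simp, ?_, ?_⟩
    · exact List.pairwise_map.2 (hd.imp fun h => h)
    · exact List.pairwise_map.2 ((List.pairwise_cons.1 hr).2.imp fun h => h)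
  · rintro ⟨d, r, he, hd, hr⟩
    obtain ⟨d, r, rfl, rfl, rfl⟩ := List.map_eq_append_iff.1 he
    have hd : d.Pairwise (fun a b => a ≥ b) := (List.pairwise_map.1 hd).imp fun h => h
    have hr : r.Pairwise (fun a b => a < b) := (List.pairwise_map.1 hr).imp fun h => h
    rcases r with _ | ⟨c', r⟩
    · rcases List.eq_nil_or_concat d with rfl | ⟨d, c, rfl⟩
      · simp at hu
      · exact ⟨d, c, [], by simp, by simpa using hd, by simp⟩
    · rcases List.eq_nil_or_concat d with rfl | ⟨d, c, rfl⟩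
      · exact ⟨[], c', r, rfl, by simp, hr⟩
      · rw [List.concat_eq_append] at *
        rcases lt_or_ge c c' with hc | hc
        · refine ⟨d, c, c' :: r, by simp, hd, List.pairwise_cons.2 ⟨?_, hr⟩⟩
          intro b hb
          rcases List.mem_cons.1 hb with rfl | hb
          · exact hc
          · exact hc.trans ((List.pairwise_cons.1 hr).1 b hb)
        · refine ⟨d ++ [c], c', r, by simp, List.pairwise_append.2 ⟨hd, by simp, ?_⟩, hr⟩
          intro a ha b hb
          rw [List.mem_singleton.1 hb]
          rcases List.mem_append.1 ha with ha | ha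
          · exact le_trans hc ((List.pairwise_append.1 hd).2.2 a ha c (by simp))
          · rw [List.mem_singleton.1 ha]; exact hc

/-- The padding letters form a constant prefix above all other letters, so they can be put in front
of the decreasing part. -/
theorem isHook_padded_iff (hle : ∀ p, mu.part p ≤ lam.part p) (p : ℕ) :
    IsHook (rowWord (padded T p) (lam.part p)) ↔
      (SkewTableau.row T p ≠ [] → IsHookWord (SkewTableau.row T p)) := by
  constructor
  · intro h hne
    rw [isHookWord_iff hne, ← filter_rowWord_padded]
    exact h.sublist List.filter_sublist
  · intro h
    have h' : IsHook ((SkewTableau.row T p).map Subtype.val) := by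
      by_cases hne : SkewTableau.row T p = []
      · rw [hne]; exact ⟨[], [], rfl, by simp, by simp⟩
      · exact (isHookWord_iff hne).1 (h hne)
    have hsplit := rowWord_add (padded T p) (mu.part p) (lam.part p - mu.part p)
    rw [Nat.add_sub_cancel' (hle p)] at hsplit
    have hbig : ∀ a ∈ rowWord (padded T p) (mu.part p), a = n + mu.part p ∧ 0 < mu.part p := by
      intro a ha
      obtain ⟨k, hk, rfl⟩ := mem_rowWord.1 ha
      exact ⟨padded_of_lt hk, by omega⟩
    have hsmall : ∀ a ∈ rowWord (fun k => padded T p (mu.part p + k)) (lam.part p - mu.part p),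
        a ≤ n := by
      intro a ha
      obtain ⟨k, hk, rfl⟩ := mem_rowWord.1 ha
      exact (padded_le_iff (by omega)).2 (by omega)
    rw [← filter_rowWord_padded, hsplit, List.filter_append, List.filter_eq_nil_iff.2,
      List.nil_append, List.filter_eq_self.2] at h'
    · obtain ⟨d, r, he, hd, hr⟩ := h'
      refine ⟨rowWord (padded T p) (mu.part p) ++ d, r, by rw [hsplit, he, List.append_assoc], ?_,
        hr⟩
      refine List.pairwise_append.2 ⟨?_, hd, fun a ha b hb => ?_⟩
      · exact pairwise_rowWord.2 fun a b hab hb => by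
          rw [padded_of_lt hb, padded_of_lt (hab.trans hb)]
      · have h1 := (hbig a ha).1
        have h2 := hsmall b (by rw [he]; exact List.mem_append_left _ hb)
        omega
    · intro a ha
      simpa using hsmall a ha
    · intro a ha
      have := hbig a ha
      simp
      omega

/-- A padding letter in row `k + 1` has a larger one in row `k` on each diagonal weakly to its left,
so it adds nothing to the first condition. A padding letter in row `k` bounds its whole row, so the
second condition holds for it. Elsewhere the boxes in question lie in the skew shape. -/
theorem rowsCompatible_padded_iff (k : ℕ) :
    RowsCompatible (padded T k) (padded T (k + 1)) (lam.part (k + 1)) ↔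
      (∀ i j, i ≤ j → j < lam.part (k + 1) →
        ∀ a ∈ SkewTableau.entry T k i, ∀ b ∈ SkewTableau.entry T (k + 1) j, a ≤ b →
          i ≠ 0 ∧ ∃ c ∈ SkewTableau.entry T (k + 1) (i - 1), c < b) ∧
      (∀ i j, i ≤ j → j < lam.part (k + 1) →
        ∀ a ∈ SkewTableau.entry T k i, ∀ b ∈ SkewTableau.entry T (k + 1) j, a > b →
          ∃ c ∈ SkewTableau.entry T k (j + 1), a ≥ c) := by
  have hmu := mu.part_succ_le k
  refine and_congr (forall₄_congr fun i j hij hj => ?_) (forall₄_congr fun i j hij hj => ?_)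
  · have hlam := lam.part_succ_lt (k := k) (by omega)
    constructor
    · intro h a ha b hb hab
      rw [mem_entry_iff] at ha hb
      have hab' : a.1 ≤ b.1 := hab
      obtain ⟨h0, h1⟩ := h (by omega)
      have h2 : padded T (k + 1) (i - 1) ≤ n := by have := b.2.2; omega
      rw [padded_le_iff (by omega)] at h2
      obtain ⟨c, hc, hpc⟩ := exists_mem_entry (T := T) (p := k + 1) (q := i - 1) ⟨h2, by omega⟩
      exact ⟨h0, c, hc, show c.1 < b.1 by omega⟩
    · intro h hle'
      by_cases hbj : j < mu.part (k + 1)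
      · have := mu.part_succ_lt (k := k) (by omega)
        rw [padded_of_lt hbj, padded_of_lt (by omega)] at hle'
        omega
      · obtain ⟨b, hb, hpb⟩ := exists_mem_entry (T := T) (p := k + 1) (q := j) ⟨by omega, hj⟩
        have hi : padded T k i ≤ n := by have := b.2.2; omega
        rw [padded_le_iff (by omega)] at hi
        obtain ⟨a, ha, hpa⟩ := exists_mem_entry (T := T) (p := k) (q := i) ⟨hi, by omega⟩
        obtain ⟨h0, c, hc, hcb⟩ := h a ha b hb (show a.1 ≤ b.1 by omega)
        refine ⟨h0, ?_⟩
        rw [(mem_entry_iff.1 hc).2, hpb]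
        exact hcb
  · have hlam := lam.part_succ_lt (k := k) (by omega)
    constructor
    · intro h a ha b hb hab
      rw [mem_entry_iff] at ha hb
      have hab' : b.1 < a.1 := hab
      have h1 := h (by omega)
      obtain ⟨c, hc, hpc⟩ := exists_mem_entry (T := T) (p := k) (q := j + 1)
        ⟨by omega, by omega⟩
      exact ⟨c, hc, show c.1 ≤ a.1 by omega⟩
    · intro h hlt
      by_cases hi : i < mu.part k
      · rw [padded_of_lt hi]
        by_cases hj' : j + 1 < mu.part k
        · rw [padded_of_lt hj']
        · have := (padded_le_iff (T := T) (p := k) (q := j + 1) (by omega)).2 (by omega)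
          omega
      · obtain ⟨a, ha, hpa⟩ := exists_mem_entry (T := T) (p := k) (q := i) ⟨by omega, by omega⟩
        obtain ⟨b, hb, hpb⟩ := exists_mem_entry (T := T) (p := k + 1) (q := j) ⟨by omega, hj⟩
        obtain ⟨c, hc, hca⟩ := h a ha b hb (show b.1 < a.1 by omega)
        rw [(mem_entry_iff.1 hc).2, hpa]
        exact hca

theorem isSkewSSDT_iff_rowsCompatible (hle : ∀ p, mu.part p ≤ lam.part p) :
    SkewTableau.IsSkewSSDT T ↔ (∀ k, IsHook (rowWord (padded T k) (lam.part k))) ∧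
      ∀ k, RowsCompatible (padded T k) (padded T (k + 1)) (lam.part (k + 1)) := by
  simp only [rowsCompatible_padded_iff, isHook_padded_iff hle]
  exact ⟨fun h => ⟨h.hook, fun k => ⟨h.cond_one k, h.cond_two k⟩⟩,
    fun h => ⟨h.1, fun k => (h.2 k).1, fun k => (h.2 k).2⟩⟩

/-- Skew semistandard decomposition tableaux in terms of hook subwords. -/
theorem isSkewSSDT_iff (hle : ∀ p, mu.part p ≤ lam.part p) :
    SkewTableau.IsSkewSSDT T ↔ (∀ k, IsHook (rowWord (padded T k) (lam.part k))) ∧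
      ∀ k, lam.part (k + 1) ≠ 0 → ∀ s, IsHook s →
        s.Sublist (rowWord (padded T (k + 1)) (lam.part (k + 1)) ++
          rowWord (padded T k) (lam.part k)) → s.length ≤ lam.part k := by
  rw [isSkewSSDT_iff_rowsCompatible hle]
  refine and_congr_right fun hh => forall_congr' fun k => ?_
  constructor
  · intro h hk s hs hsub
    exact h.length_le (lam.part_succ_lt hk) (hh k) (hh (k + 1)) hs hsub
  · intro h
    by_cases hk : lam.part (k + 1) = 0
    · rw [hk]
      exact ⟨fun i j _ hj => absurd hj (Nat.not_lt_zero j),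
        fun i j _ hj => absurd hj (Nat.not_lt_zero j)⟩
    · exact .of_length_le (lam.part_succ_lt hk) (hh k) (hh (k + 1)) (h hk)

end Padding

/-! ## Boxes -/

/-- The boxes `(row, diagonal)` of row `p`, from left to right. -/
def rowBoxes (lam : StrictPartition) (p : ℕ) : List (ℕ × ℕ) :=
  (List.range (lam.part p)).map fun q => (p, q)

/-- The boxes `(row, diagonal)` of a shifted diagram in the order of the reversed reading word. -/
noncomputable def boxes (lam : StrictPartition) : List (ℕ × ℕ) :=
  (List.range lam.length).reverse.flatMap (rowBoxes lam)

theorem map_rowBoxes (lam : StrictPartition) (F : ℕ × ℕ → ℕ) (p : ℕ) :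
    (rowBoxes lam p).map F = rowWord (fun q => F (p, q)) (lam.part p) := by
  simp [rowBoxes, rowWord, Function.comp_def]

theorem mem_rowBoxes {lam : StrictPartition} {p : ℕ} {b : ℕ × ℕ} :
    b ∈ rowBoxes lam p ↔ b.1 = p ∧ b.2 < lam.part p := by
  obtain ⟨b₁, b₂⟩ := b
  simp only [rowBoxes, List.mem_map, List.mem_range, Prod.mk.injEq]
  constructor
  · rintro ⟨q, hq, rfl, rfl⟩; exact ⟨rfl, hq⟩
  · rintro ⟨rfl, hq⟩; exact ⟨b₂, hq, rfl, rfl⟩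

theorem mem_boxes {lam : StrictPartition} {b : ℕ × ℕ} : b ∈ boxes lam ↔ b.2 < lam.part b.1 := by
  simp only [boxes, List.mem_flatMap, List.mem_reverse, List.mem_range, mem_rowBoxes,
    ← lam.part_ne_zero_iff]
  constructor
  · rintro ⟨p, hp, rfl, h⟩; exact h
  · intro h; exact ⟨b.1, by omega, rfl, h⟩

theorem nodup_boxes (lam : StrictPartition) : (boxes lam).Nodup := by
  rw [boxes, List.nodup_flatMap]
  refine ⟨fun p _ => List.nodup_range.map fun a b h => (Prod.mk.inj h).2, ?_⟩
  refine (List.nodup_reverse.2 List.nodup_range).imp fun {a b} hab => ?_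
  intro x hx hx'
  exact hab ((mem_rowBoxes.1 hx).1.symm.trans (mem_rowBoxes.1 hx').1)

theorem exists_reverse_range (k m : ℕ) :
    ∃ P, (List.range (k + m)).reverse = P ++ (List.range k).reverse := by
  induction m with
  | zero => exact ⟨[], rfl⟩
  | succ m ih =>
    obtain ⟨P, hP⟩ := ih
    exact ⟨(k + m) :: P, by rw [← add_assoc, List.range_succ, List.reverse_append, hP]; rfl⟩

theorem rowBoxes_infix (lam : StrictPartition) {k : ℕ} (hk : lam.part k ≠ 0) :
    rowBoxes lam k <:+: boxes lam := by
  rw [lam.part_ne_zero_iff] at hk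
  obtain ⟨m, hm⟩ := Nat.exists_eq_add_of_le (Nat.succ_le_of_lt hk)
  obtain ⟨P, hP⟩ := exists_reverse_range (k + 1) m
  rw [boxes, hm, Nat.succ_eq_add_one, hP, List.range_succ]
  exact ⟨P.flatMap (rowBoxes lam), (List.range k).reverse.flatMap (rowBoxes lam), by simp⟩

theorem rowBoxes_append_infix (lam : StrictPartition) {k : ℕ} (hk : lam.part (k + 1) ≠ 0) :
    rowBoxes lam (k + 1) ++ rowBoxes lam k <:+: boxes lam := by
  rw [lam.part_ne_zero_iff] at hk
  obtain ⟨m, hm⟩ := Nat.exists_eq_add_of_le (Nat.succ_le_of_lt hk)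
  obtain ⟨P, hP⟩ := exists_reverse_range (k + 1 + 1) m
  rw [boxes, hm, Nat.succ_eq_add_one, hP, List.range_succ, List.range_succ]
  exact ⟨P.flatMap (rowBoxes lam), (List.range k).reverse.flatMap (rowBoxes lam), by simp⟩

/-- A move in a word does not change the lengths of the hook subwords of its factors. -/
theorem exists_hook_of_infix {β : Type*} {l₁ l₂ M : List β} {b : β} {F F' : β → ℕ}
    (hnd : (l₁ ++ b :: l₂).Nodup) (hM : M <:+: l₁ ++ b :: l₂) (hF : ∀ c ≠ b, F' c = F c)
    (hmove : Move (l₁.map F) (l₂.map F) (F b) (F' b)) (hpos : ∀ c ∈ l₁ ++ b :: l₂, 1 ≤ F c)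
    {s : List ℕ} (hs : IsHook s) (hsub : s.Sublist (M.map F)) :
    ∃ s', IsHook s' ∧ s'.Sublist (M.map F') ∧ s'.length = s.length := by
  by_cases hb : b ∈ M
  · obtain ⟨m₁, m₂, rfl⟩ := List.append_of_mem hb
    obtain ⟨P, Q, hPQ⟩ := hM
    have hPQ' : (P ++ m₁) ++ b :: (m₂ ++ Q) = l₁ ++ b :: l₂ := by simpa using hPQ
    have hnd' := hnd
    rw [← hPQ'] at hnd'
    rw [List.nodup_middle, List.nodup_cons, List.mem_append, not_or] at hnd hnd'
    -- Boxes are distinct, so the two splittings at `b` coincide.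
    obtain ⟨rfl, -, rfl⟩ := (List.append_cons_inj_of_notMem hnd'.1.1 hnd'.1.2).1 hPQ'
    rw [List.map_append, List.map_append] at hmove
    have hcongr : ∀ {A : List β}, b ∉ A → A.map F' = A.map F := fun {A} hA =>
      List.map_congr_left fun c hc => hF c fun h => hA (h ▸ hc)
    have h1 := hnd.1
    rw [List.map_append, List.map_cons] at hsub ⊢
    rw [hcongr fun h => h1.1 (by simp [h]), hcongr fun h => h1.2 (by simp [h])]
    refine hmove.of_append.exists_hook ?_ ?_ hs hsub
    · intro a ha
      obtain ⟨c, hc, rfl⟩ := List.mem_map.1 ha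
      exact hpos c (by simp [hc])
    · intro a ha
      obtain ⟨c, hc, rfl⟩ := List.mem_map.1 ha
      exact hpos c (by simp [hc])
  · refine ⟨s, hs, ?_, rfl⟩
    rwa [List.map_congr_left fun c hc => hF c fun h => hb (h ▸ hc)]

/-! ### Injectivity of the reading word and stability of tableaux under moves -/

section Closure

variable {n : ℕ} {lam mu : StrictPartition}

theorem revWord_eq (T : SkewTableau lam mu (Letter n)) :
    (SkewTableau.revWord T).map Subtype.val =
      ((boxes lam).map fun b => padded T b.1 b.2).filter (· ≤ n) := by
  rw [SkewTableau.revWord, SkewTableau.word, List.reverse_flatMap, boxes, List.map_flatMap,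
    List.map_flatMap, List.filter_flatMap]
  congr 1
  funext p
  rw [Function.comp_apply, List.reverse_reverse, map_rowBoxes, filter_rowWord_padded]

theorem padded_injective (T T' : SkewTableau lam mu (Letter n))
    (h : ∀ b ∈ boxes lam, padded T b.1 b.2 = padded T' b.1 b.2) : T = T' := by
  funext ⟨⟨p, c⟩, hc⟩
  obtain ⟨⟨h1, h2⟩, h3⟩ := id hc
  simp only at h1 h2
  obtain ⟨q, rfl⟩ := Nat.exists_eq_add_of_le h1
  have hq : mu.part p ≤ q ∧ q < lam.part p := by
    refine ⟨?_, by omega⟩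
    by_contra! hlt
    exact h3 ⟨h1, by simpa using hlt⟩
  have := h (p, q) (mem_boxes.2 hq.2)
  simp only [padded, dif_pos hq] at this
  exact Subtype.ext this

/-- Which boxes survive the deletion of letters above `n` depends on the shape alone, so equal words
agree box by box; the tableau conditions play no role. -/
theorem revWord_injective :
    Function.Injective (SkewTableau.revWord : SkewTableau lam mu (Letter n) → List (Letter n)) := by
  intro T T' h
  have h' := congrArg (List.map Subtype.val) h
  rw [revWord_eq, revWord_eq] at h'
  refine padded_injective T T' ?_
  have key : ∀ l : List (ℕ × ℕ), (∀ b ∈ l, b ∈ boxes lam) →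
      (l.map fun b => padded T b.1 b.2).filter (· ≤ n) =
        (l.map fun b => padded T' b.1 b.2).filter (· ≤ n) →
      ∀ b ∈ l, padded T b.1 b.2 = padded T' b.1 b.2 := by
    intro l hl
    induction l with
    | nil => simp
    | cons b l ih =>
      intro he
      have hb := mem_boxes.1 (hl b (by simp))
      have ih := ih fun b hb => hl b (List.mem_cons_of_mem _ hb)
      rw [List.map_cons, List.map_cons, List.filter_cons, List.filter_cons] at he
      simp only [padded_le_iff hb] at he
      by_cases hmu : mu.part b.1 ≤ b.2
      · simp only [hmu, decide_true, if_true] at he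
        obtain ⟨h1, h2⟩ := List.cons.inj he
        exact List.forall_mem_cons.2 ⟨h1, ih h2⟩
      · simp only [hmu, decide_false, Bool.false_eq_true, if_false] at he
        refine List.forall_mem_cons.2 ⟨?_, ih he⟩
        rw [padded_of_lt (by omega), padded_of_lt (by omega)]
  exact key _ (fun _ h => h) h'

theorem padded_update [DecidableEq ↥(lam.shiftedDiagram \ mu.shiftedDiagram)]
    (T : SkewTableau lam mu (Letter n)) {p q : ℕ} (h : mu.part p ≤ q ∧ q < lam.part p)
    (y : Letter n) (b : ℕ × ℕ) :
    padded (Function.update T ⟨(p, p + q), box_mem h⟩ y) b.1 b.2 =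
      if b = (p, q) then y.1 else padded T b.1 b.2 := by
  obtain ⟨p', q'⟩ := b
  split_ifs with hb
  · obtain ⟨rfl, rfl⟩ := Prod.mk.inj hb
    simp [padded, h]
  · unfold padded
    split_ifs with h'
    · rw [Function.update_of_ne]
      intro he
      obtain ⟨h1, h2⟩ : p' = p ∧ p' + q' = p + q := Prod.mk.inj (Subtype.ext_iff.1 he)
      exact hb (by rw [Prod.mk.injEq]; omega)
    · rfl

/-- The tableaux form a set of words that is stable under moves. -/
theorem exists_tableau_of_move (hle : ∀ p, mu.part p ≤ lam.part p)
    {T : SkewTableau lam mu (Letter n)} (hT : SkewTableau.IsSkewSSDT T)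
    {A B : List (Letter n)} {x y : Letter n} (hw : SkewTableau.revWord T = A ++ x :: B)
    (hmove : Move (A.map Subtype.val) (B.map Subtype.val) x.1 y.1) :
    ∃ T', SkewTableau.IsSkewSSDT T' ∧ SkewTableau.revWord (T' : SkewTableau lam mu (Letter n)) =
      A ++ y :: B := by
  classical
  set F : ℕ × ℕ → ℕ := fun b => padded T b.1 b.2 with hFdef
  have hfil := revWord_eq T
  rw [hw, List.map_append, List.map_cons, eq_comm, List.filter_eq_append_iff] at hfil
  obtain ⟨W₁, W₂, hW, hA, hB⟩ := hfil
  obtain ⟨C, D, rfl, hC, hxn, hD⟩ := List.filter_eq_cons_iff.1 hB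
  rw [← List.append_assoc] at hW
  obtain ⟨l₁, l₂', hl, hl₁, hl₂'⟩ := List.map_eq_append_iff.1 hW
  obtain ⟨⟨p, q⟩, l₂, rfl, hFb, hl₂⟩ := List.map_eq_cons_iff.1 hl₂'
  have hA' : (l₁.map F).filter (· ≤ n) = A.map Subtype.val := by
    rw [hl₁, List.filter_append, hA, List.filter_eq_nil_iff.2 hC, List.append_nil]
  have hB' : (l₂.map F).filter (· ≤ n) = B.map Subtype.val := by rw [hl₂, hD]
  have hq : q < lam.part p := mem_boxes.1 (show (p, q) ∈ boxes lam by simp [hl])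
  have hpq : mu.part p ≤ q ∧ q < lam.part p :=
    ⟨(padded_le_iff (T := T) hq).1 (by rw [show padded T p q = x.1 from hFb]; exact x.2.2), hq⟩
  set T' : SkewTableau lam mu (Letter n) := Function.update T ⟨(p, p + q), box_mem hpq⟩ y
  set F' : ℕ × ℕ → ℕ := fun b => padded T' b.1 b.2 with hFdef'
  have hupd : ∀ b, F' b = if b = (p, q) then y.1 else F b := padded_update T hpq y
  have hnd := nodup_boxes lam
  rw [hl] at hnd
  have hne : ∀ c ≠ (p, q), F' c = F c := fun c hc => by rw [hupd, if_neg hc]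
  have hF'b : F' (p, q) = y.1 := by rw [hupd, if_pos rfl]
  have hnd' := hnd
  rw [List.nodup_append, List.nodup_cons] at hnd'
  have hl₁' : l₁.map F' = l₁.map F :=
    List.map_congr_left fun c hc => hne c fun h => hnd'.2.2 c hc (p, q) (by simp) h
  have hl₂' : l₂.map F' = l₂.map F :=
    List.map_congr_left fun c hc => hne c fun h => hnd'.2.1.1 (h ▸ hc)
  have hM : Move (l₁.map F) (l₂.map F) (F (p, q)) (F' (p, q)) := by
    rw [hF'b, show F (p, q) = x.1 from hFb]
    -- The move is lifted from the skew word to the padded word.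
    exact Move.of_filter x.2.2 y.2.2 (by rw [hA', hB']; exact hmove)
  have hpos : ∀ c ∈ l₁ ++ (p, q) :: l₂, 1 ≤ F c := fun c hc =>
    padded_pos (mem_boxes.1 (hl ▸ hc))
  have hpos' : ∀ c ∈ l₁ ++ (p, q) :: l₂, 1 ≤ F' c := fun c hc =>
    padded_pos (mem_boxes.1 (hl ▸ hc))
  refine ⟨T', ?_, ?_⟩
  · rw [isSkewSSDT_iff hle] at hT ⊢
    refine ⟨fun k => ?_, fun k hk s hs hsub => ?_⟩
    · by_cases hk : lam.part k = 0
      · rw [hk]; exact ⟨[], [], rfl, by simp, by simp⟩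
      · have hinf := rowBoxes_infix lam hk
        rw [hl] at hinf
        -- The old row is a hook of full length; its counterpart is a subword of the new row of the
        -- same length, hence the whole new row.
        obtain ⟨s, h1, h2, h3⟩ := exists_hook_of_infix hnd hinf hne hM hpos (hT.1 k)
          (s := rowWord (padded T k) (lam.part k)) (by rw [map_rowBoxes])
        rw [map_rowBoxes] at h2
        rwa [← h2.eq_of_length (by rw [h3, length_rowWord, length_rowWord])]
    · have hinf := rowBoxes_append_infix lam hk
      rw [hl] at hinf
      -- The length bound is carried over by the inverse move, which takes hooks of the new word
      -- back to the old one.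
      obtain ⟨s', h1, h2, h3⟩ := exists_hook_of_infix (F := F') (F' := F) hnd hinf
        (fun c hc => (hne c hc).symm) (by rw [hl₁', hl₂']; exact hM.symm) hpos' hs
        (by rw [List.map_append, map_rowBoxes, map_rowBoxes]; exact hsub)
      rw [List.map_append, map_rowBoxes, map_rowBoxes] at h2
      rw [← h3]
      exact hT.2 k hk s' h1 h2
  · apply List.map_injective_iff.2 Subtype.val_injective
    rw [revWord_eq, hl]
    change ((l₁ ++ (p, q) :: l₂).map F').filter (· ≤ n) = _
    rw [List.map_append, List.map_cons, hl₁', hl₂', List.filter_append,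
      List.filter_cons_of_pos (by rw [hF'b]; simpa using y.2.2), hA', hB', hF'b]
    simp

end Closure

end SkewSSDT

open SkewSSDT
theorem proposition6p2 (n : ℕ) (hn : 2 ≤ n) (lam mu : StrictPartition)
    (hsub : mu.shiftedDiagram ⊆ lam.shiftedDiagram) (hlen : lam.length ≤ n) :
    -- the reversed reading word is injective on `B_n(lam / mu)`
    Set.InjOn SkewTableau.revWord (skewB n lam mu) ∧
    -- its image together with `0` is invariant under all `e_i`, `f_i` with `i ∈ I`
    (∀ (i : QIndex n), ∀ w ∈ SkewTableau.revWord '' skewB n lam mu,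
      (∀ w', (wordCrystal n).e i w = some w' → w' ∈ SkewTableau.revWord '' skewB n lam mu) ∧
      (∀ w', (wordCrystal n).f i w = some w' → w' ∈ SkewTableau.revWord '' skewB n lam mu)) ∧
    -- `B_n(lam / mu)` is a `q(n)`-crystal with the maps induced from those on words
    ∃ C : CrystalData n (skewB n lam mu), C.IsQCrystal ∧
      (∀ T, C.wt T = (wordCrystal n).wt (SkewTableau.revWord T.1)) ∧
      (∀ i T, C.ε i T = (wordCrystal n).ε i (SkewTableau.revWord T.1)) ∧
      (∀ i T, C.φ i T = (wordCrystal n).φ i (SkewTableau.revWord T.1)) ∧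
      (∀ i T, (C.e i T).map (fun T' => SkewTableau.revWord T'.1) =
        (wordCrystal n).e i (SkewTableau.revWord T.1)) ∧
      (∀ i T, (C.f i T).map (fun T' => SkewTableau.revWord T'.1) =
        (wordCrystal n).f i (SkewTableau.revWord T.1)) := by
  have hle := StrictPartition.part_le_of_subset hsub
  have hclosed : ∀ T ∈ skewB n lam mu, ∀ w',
      (∃ A B x y, SkewTableau.revWord T = A ++ x :: B ∧ w' = A ++ y :: B ∧
        Move (A.map Subtype.val) (B.map Subtype.val) x.1 y.1) →
      w' ∈ SkewTableau.revWord '' skewB n lam mu := by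
    rintro T hT w' ⟨A, B, x, y, h1, rfl, hm⟩
    exact exists_tableau_of_move hle hT h1 hm
  have he : ∀ i, ∀ T ∈ skewB n lam mu, ∀ w', (wordCrystal n).e i (SkewTableau.revWord T) = some w' →
      w' ∈ SkewTableau.revWord '' skewB n lam mu := fun i T hT w' h =>
    hclosed T hT w' (exists_move_of_e i h)
  have hf : ∀ i, ∀ T ∈ skewB n lam mu, ∀ w', (wordCrystal n).f i (SkewTableau.revWord T) = some w' →
      w' ∈ SkewTableau.revWord '' skewB n lam mu := fun i T hT w' h =>
    hclosed T hT w' (exists_move_of_f i h)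
  set g : skewB n lam mu → List (Letter n) := fun T => SkewTableau.revWord T.1
  have hg : Function.Injective g := revWord_injective.comp Subtype.val_injective
  have hrange : Set.range g = SkewTableau.revWord '' skewB n lam mu := by
    rw [Set.image_eq_range]
  have he' : ∀ i T w, (wordCrystal n).e i (g T) = some w → w ∈ Set.range g := fun i T w h =>
    hrange ▸ he i T.1 T.2 w h
  have hf' : ∀ i T w, (wordCrystal n).f i (g T) = some w → w ∈ Set.range g := fun i T w h =>
    hrange ▸ hf i T.1 T.2 w h
  refine ⟨revWord_injective.injOn, ?_, (wordCrystal n).induced g,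
    (wordCrystal_isQCrystal n).induced hg he' hf', fun _ => rfl, fun _ _ => rfl, fun _ _ => rfl,
    fun i T => map_bind_partialInv hg (he' i T), fun i T => map_bind_partialInv hg (hf' i T)⟩
  rintro i _ ⟨T, hT, rfl⟩
  exact ⟨he i T hT, hf i T hT⟩
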